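/- Work in $\mathfrak H=L^2(\mathbb R,dx)$ with $(Q\varphi)(x)=x\varphi(x)$, $(P\varphi)(x)=-i\varphi'(x)$, $a=(Q+iP)/\sqrt2$, $a^\dagger=(Q-iP)/\sqrt2$, all acting on the Schwartz space $\mathcal S(\mathbb R)$. For $z=(q+ip)/\sqrt2\in\mathbb C$ let $D(z)=e^{za^\dagger-\bar z a}$ be the unitary displacement operator, $(D(z)\varphi)(x)=e^{ip(x-q/2)}\varphi(x-q)$. Let $\varpi:\mathbb C\to\mathbb C$ be a weight which is $C^2$ near $0$ and which defines a bounded operator $\mathsf M=\int_{\mathbb C}\varpi(z)D(z)\,\frac{d^2z}{\pi}$ weakly on $\mathcal S(\mathbb R)$: for all $\varphi,\psi\in\mathcal S(\mathbb R)$ the function $z\mapsto\varpi(z)\langle\varphi,D(z)\psi\rangle$ is integrable and $\langle\varphi,\mathsf M\psi\rangle=\int_{\mathbb C}\varpi(z)\langle\varphi,D(z)\psi\rangle\frac{d^2z}{\pi}$. Put $\mathsf M(z)=D(z)\mathsf MD(z)^\dagger$. For $f:\mathbb C\to\mathbb C$ and a linear operator $A$ on $\mathcal S(\mathbb R)$,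 write $$A_f=\int_{\mathbb C}f(z)\,\mathsf M(z)\,\frac{d^2z}{\pi}=A$$ if for all $\varphi,\psi\in\mathcal S(\mathbb R)$ one has $\langle\varphi,A\psi\rangle=\int_{\mathbb C}f(z)\langle\varphi,\mathsf M(z)\psi\rangle\frac{d^2z}{\pi}$ as an oscillatory integral, that is, for every Schwartz function $\chi$ on $\mathbb C$ with $\chi(0)=1$ and every $\varepsilon>0$ the function $z\mapsto\chi(\varepsilon z)f(z)\langle\varphi,\mathsf M(z)\psi\rangle$ is integrable, and $$\langle\varphi,A\psi\rangle=\lim_{\varepsilon\to0^+}\int_{\mathbb C}\chi(\varepsilon z)f(z)\langle\varphi,\mathsf M(z)\psi\rangle\frac{d^2z}{\pi}.$$ (This is the Lebesgue integral whenever the latter converges absolutely, and $f$ and $\mathsf M$ determine $A$.) Let $\partial_z,\partial_{\bar z}$ be the Wirtinger derivatives. 1. One has $$A_{|z|^2}=\varpi(0)\,a^\dagger a+\partial_z\varpi(0)\,a-\partial_{\bar z}\varpi(0)\,a^\dagger+\frac{\varpi(0)}2-\partial_z\partial_{\bar z}\varpi(0).$$ 2. Suppose that the weight is regular: $\varpi(0)=1$,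 $\varpi(-z)=\varpi(z)$ and $\overline{\varpi(z)}=\varpi(z)$ for all $z$. Then $$A_{|z|^2}=a^\dagger a+\tfrac12-\partial_z\partial_{\bar z}\varpi(0),$$ $$A_{q^2}=Q^2-\partial_z\partial_{\bar z}\varpi(0)+\tfrac12\left(\partial_z^2\varpi(0)+\partial_{\bar z}^2\varpi(0)\right),$$ $$A_{p^2}=P^2-\partial_z\partial_{\bar z}\varpi(0)-\tfrac12\left(\partial_z^2\varpi(0)+\partial_{\bar z}^2\varpi(0)\right).$$ For an operator $A$ on $\mathcal S(\mathbb R)$ with real expectation values, let $\min(A)$ be the infimum of $\langle\varphi,A\varphi\rangle$ over $\varphi\in\mathcal S(\mathbb R)$ with $\|\varphi\|=1$. The three operators have real expectation values and finite minima, the ground state energy $E_0=\min(A_{|z|^2})$ is an eigenvalue of $A_{|z|^2}$, and, with $E_m=[\min(A_{q^2})+\min(A_{p^2})]/2$, $$E_0=\tfrac12-\partial_z\partial_{\bar z}\varpi(0),\qquad E_m=-\partial_z\partial_{\bar z}\varpi(0),\qquad E_0-E_m=\tfrac12.$$ -/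

import Mathlib

open MeasureTheory Filter Topology SchwartzMap
open scoped ComplexConjugate ENNReal

noncomputable section

namespace IntegralQuantization

/-- The Hilbert space `L²(ℝ, dx)` of the Schrödinger representation. -/
abbrev Hilb : Type := Lp ℂ 2 (volume : Measure ℝ)

/-- The vector of `L²(ℝ, dx)` defined by a Schwartz function. -/
abbrev vec (φ : 𝓢(ℝ, ℂ)) : Hilb := φ.toLp 2 volume

/-! ### Classical phase space: `z = (q + i p) / √2` -/

/-- The position coordinate `q = √2 Re z`. -/
def qOf (z : ℂ) : ℝ := √2 * z.re

/-- The momentum coordinate `p = √2 Im z`. -/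
def pOf (z : ℂ) : ℝ := √2 * z.im

/-- The Wirtinger derivative `∂_z = (∂_x - i ∂_y) / 2`, where `z = x + i y`. -/
def dz (f : ℂ → ℂ) (w : ℂ) : ℂ :=
  (fderiv ℝ f w 1 - Complex.I * fderiv ℝ f w Complex.I) / 2

/-- The Wirtinger derivative `∂_{z̄} = (∂_x + i ∂_y) / 2`, where `z = x + i y`. -/
def dzbar (f : ℂ → ℂ) (w : ℂ) : ℂ :=
  (fderiv ℝ f w 1 + Complex.I * fderiv ℝ f w Complex.I) / 2

/-! ### Displacement operators -/

/-- `(U(q,p) φ)(x) = e^{i p (x - q/2)} φ(x - q)`, on functions. -/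
def displaceFun (z : ℂ) (φ : ℝ → ℂ) (x : ℝ) : ℂ :=
  Complex.exp (Complex.I * ((pOf z * (x - qOf z / 2) : ℝ) : ℂ)) * φ (x - qOf z)

theorem norm_displaceFun (z : ℂ) (φ : ℝ → ℂ) (x : ℝ) :
    ‖displaceFun z φ x‖ = ‖φ (x - qOf z)‖ := by
  rw [displaceFun, norm_mul, mul_comm Complex.I, Complex.norm_exp_ofReal_mul_I, one_mul]

theorem displaceFun_congr (z : ℂ) {φ ψ : ℝ → ℂ} (h : φ =ᵐ[volume] ψ) :
    displaceFun z φ =ᵐ[volume] displaceFun z ψ := by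
  have h' := (measurePreserving_sub_right (volume : Measure ℝ) (qOf z)).quasiMeasurePreserving.ae h
  filter_upwards [h'] with x hx
  simp only [displaceFun, hx]

theorem aestronglyMeasurable_displaceFun (z : ℂ) {φ : ℝ → ℂ}
    (h : AEStronglyMeasurable φ volume) : AEStronglyMeasurable (displaceFun z φ) volume := by
  have h1 : AEStronglyMeasurable (fun x => φ (x - qOf z)) volume :=
    h.comp_measurePreserving (measurePreserving_sub_right (volume : Measure ℝ) (qOf z))
  have h2 : Continuous fun x : ℝ =>
      Complex.exp (Complex.I * ((pOf z * (x - qOf z / 2) : ℝ) : ℂ)) := by fun_prop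
  exact h2.aestronglyMeasurable.mul h1

theorem eLpNorm_displaceFun (z : ℂ) {φ : ℝ → ℂ} (h : AEStronglyMeasurable φ volume) :
    eLpNorm (displaceFun z φ) 2 volume = eLpNorm φ 2 volume := by
  rw [eLpNorm_congr_norm_ae (g := φ ∘ fun x => x - qOf z)
    (Eventually.of_forall fun x => norm_displaceFun z φ x)]
  exact eLpNorm_comp_measurePreserving h
    (measurePreserving_sub_right (volume : Measure ℝ) (qOf z))

theorem memLp_displaceFun (z : ℂ) {φ : ℝ → ℂ} (h : MemLp φ 2 volume) :
    MemLp (displaceFun z φ) 2 volume :=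
  ⟨aestronglyMeasurable_displaceFun z h.1, by rw [eLpNorm_displaceFun z h.1]; exact h.2⟩

/-- The displacement operator `D(z) = U(q,p) = e^{z a† - z̄ a}` on `L²(ℝ, dx)`. -/
def displacement (z : ℂ) : Hilb →ₗᵢ[ℂ] Hilb where
  toFun φ := (memLp_displaceFun z (Lp.memLp φ)).toLp _
  map_add' φ ψ := by
    rw [← MemLp.toLp_add, MemLp.toLp_eq_toLp_iff]
    refine (displaceFun_congr z (Lp.coeFn_add φ ψ)).trans (Eventually.of_forall fun x => ?_)
    simp only [displaceFun, Pi.add_apply, mul_add]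
  map_smul' c φ := by
    rw [RingHom.id_apply, ← MemLp.toLp_const_smul, MemLp.toLp_eq_toLp_iff]
    refine (displaceFun_congr z (Lp.coeFn_smul c φ)).trans (Eventually.of_forall fun x => ?_)
    simp only [displaceFun, Pi.smul_apply, smul_eq_mul]
    ring
  norm_map' φ := by
    change ‖(memLp_displaceFun z (Lp.memLp φ)).toLp _‖ = ‖φ‖
    rw [Lp.norm_toLp, eLpNorm_displaceFun z (Lp.aestronglyMeasurable φ), Lp.norm_def]

/-- `D(z)` as a bounded operator. -/
def D (z : ℂ) : Hilb →L[ℂ] Hilb := (displacement z).toContinuousLinearMap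

theorem coeFn_D (z : ℂ) (φ : Hilb) : D z φ =ᵐ[volume] displaceFun z φ :=
  (memLp_displaceFun z (Lp.memLp φ)).coeFn_toLp

/-! ### Position, momentum and ladder operators, on the Schwartz domain -/

/-- `(Q φ)(x) = x φ(x)`. -/
def opQ : Module.End ℂ 𝓢(ℝ, ℂ) := (smulLeftCLM ℂ (fun x : ℝ => (x : ℂ))).toLinearMap

/-- `(P φ)(x) = -i φ'(x)`. -/
def opP : Module.End ℂ 𝓢(ℝ, ℂ) := -Complex.I • (derivCLM ℂ ℂ).toLinearMap

theorem opQ_apply (φ : 𝓢(ℝ, ℂ)) (x : ℝ) : opQ φ x = x * φ x := by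
  have h : (fun x : ℝ => (x : ℂ)).HasTemperateGrowth :=
    Complex.ofRealCLM.hasTemperateGrowth
  simp [opQ, smulLeftCLM_apply_apply h]

theorem opP_apply (φ : 𝓢(ℝ, ℂ)) (x : ℝ) : opP φ x = -Complex.I * deriv φ x := by
  simp [opP, derivCLM_apply]

/-- The lowering operator `a = (Q + i P) / √2`. -/
def opA : Module.End ℂ 𝓢(ℝ, ℂ) := ((√2 : ℝ) : ℂ)⁻¹ • (opQ + Complex.I • opP)

/-- The raising operator `a† = (Q - i P) / √2`. -/
def opAdag : Module.End ℂ 𝓢(ℝ, ℂ) := ((√2 : ℝ) : ℂ)⁻¹ • (opQ - Complex.I • opP)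

/-! ### Oscillatory integrals over the complex plane -/

/-- `L` is the value of `∫ F(z) d²z` as an oscillatory integral: for every Schwartz cut-off `χ`
with `χ(0) = 1`, the functions `χ(ε z) F(z)` are integrable and their integrals tend to `L`
as `ε → 0⁺`. -/
def HasOscIntegral (F : ℂ → ℂ) (L : ℂ) : Prop :=
  ∀ χ : 𝓢(ℂ, ℂ), χ 0 = 1 →
    (∀ ε : ℝ, 0 < ε → Integrable (fun z : ℂ => χ (ε • z) * F z)) ∧
    Tendsto (fun ε : ℝ => ∫ z : ℂ, χ (ε • z) * F z) (𝓝[>] 0) (𝓝 L)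

/-- For an integrable function the oscillatory integral is the Lebesgue integral. -/
theorem hasOscIntegral_integral {F : ℂ → ℂ} (hF : Integrable F) :
    HasOscIntegral F (∫ z, F z) := by
  intro χ hχ
  obtain ⟨C, hC⟩ : ∃ C : ℝ, ∀ x, ‖χ x‖ ≤ C := by
    obtain ⟨C, -, hC⟩ := χ.decay 0 0
    exact ⟨C, fun x => by simpa using hC x⟩
  have hm (ε : ℝ) : AEStronglyMeasurable (fun z : ℂ => χ (ε • z) * F z) volume :=
    (χ.continuous.comp (continuous_const_smul ε)).aestronglyMeasurable.mul hF.1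
  have hb (ε : ℝ) (z : ℂ) : ‖χ (ε • z) * F z‖ ≤ C * ‖F z‖ := by
    rw [norm_mul]
    exact mul_le_mul_of_nonneg_right (hC _) (norm_nonneg _)
  refine ⟨fun ε _ => (hF.norm.const_mul C).mono' (hm ε) (Eventually.of_forall (hb ε)), ?_⟩
  refine tendsto_integral_filter_of_dominated_convergence (fun z => C * ‖F z‖)
    (Eventually.of_forall hm) (Eventually.of_forall fun ε => Eventually.of_forall (hb ε))
    (hF.norm.const_mul C) (Eventually.of_forall fun z => ?_)
  have h : Continuous fun ε : ℝ => χ (ε • z) * F z := by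
    have := χ.continuous
    fun_prop
  have h0 := (h.tendsto 0).mono_left (nhdsWithin_le_nhds (s := Set.Ioi 0))
  simpa [hχ] using h0

/-- The value of an oscillatory integral is unique. -/
theorem HasOscIntegral.unique {F : ℂ → ℂ} {L L' : ℂ} (h : HasOscIntegral F L)
    (h' : HasOscIntegral F L') : L = L' := by
  let b : ContDiffBump (0 : ℂ) := ⟨1, 2, one_pos, one_lt_two⟩
  have hs : HasCompactSupport fun z : ℂ => ((b z : ℝ) : ℂ) :=
    b.hasCompactSupport.comp_left (g := fun r : ℝ => (r : ℂ)) Complex.ofReal_zero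
  have hd : ContDiff ℝ (⊤ : ℕ∞) fun z : ℂ => ((b z : ℝ) : ℂ) :=
    Complex.ofRealCLM.contDiff.comp b.contDiff
  have h1 : (hs.toSchwartzMap hd) 0 = 1 := by
    change ((b 0 : ℝ) : ℂ) = 1
    rw [b.one_of_mem_closedBall (Metric.mem_closedBall_self b.rIn_pos.le)]
    simp
  exact tendsto_nhds_unique (h _ h1).2 (h' _ h1).2

/-! ### Weights and the quantization map -/

/-- The weight `ϖ` defines the bounded operator `M = ∫ ϖ(z) D(z) d²z/π`, in the weak sense on the
dense domain of Schwartz functions. -/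
def IsWeightOperator (ϖ : ℂ → ℂ) (M : Hilb →L[ℂ] Hilb) : Prop :=
  ∀ φ ψ : 𝓢(ℝ, ℂ),
    Integrable (fun z : ℂ => ϖ z * inner ℂ (vec φ) (D z (vec ψ)) / Real.pi) ∧
    inner ℂ (vec φ) (M (vec ψ)) =
      ∫ z : ℂ, ϖ z * inner ℂ (vec φ) (D z (vec ψ)) / Real.pi

/-- The displaced operator `M(z) = D(z) M D(z)†`. -/
def displaced (M : Hilb →L[ℂ] Hilb) (z : ℂ) : Hilb →L[ℂ] Hilb :=
  D z ∘L M ∘L ContinuousLinearMap.adjoint (D z)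

/-- `A = A_f = ∫ f(z) M(z) d²z/π`, as a sesquilinear form on the Schwartz domain, the integrals
being oscillatory integrals. -/
def IsQuantization (M : Hilb →L[ℂ] Hilb) (f : ℂ → ℂ) (A : Module.End ℂ 𝓢(ℝ, ℂ)) : Prop :=
  ∀ φ ψ : 𝓢(ℝ, ℂ),
    HasOscIntegral (fun z : ℂ => f z * inner ℂ (vec φ) (displaced M z (vec ψ)) / Real.pi)
      (inner ℂ (vec φ) (vec (A ψ)))

/-- When the defining integral converges absolutely, `A_f` is given by that integral. -/
theorem IsQuantization.inner_eq_integral {M : Hilb →L[ℂ] Hilb} {f : ℂ → ℂ}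
    {A : Module.End ℂ 𝓢(ℝ, ℂ)} (h : IsQuantization M f A) (φ ψ : 𝓢(ℝ, ℂ))
    (hi : Integrable fun z : ℂ =>
      f z * inner ℂ (vec φ) (displaced M z (vec ψ)) / Real.pi) :
    inner ℂ (vec φ) (vec (A ψ)) =
      ∫ z : ℂ, f z * inner ℂ (vec φ) (displaced M z (vec ψ)) / Real.pi :=
  (h φ ψ).unique (hasOscIntegral_integral hi)

/-- Regular weights: normalised, even and real-valued. -/
structure IsRegularWeight (ϖ : ℂ → ℂ) : Prop where
  map_zero : ϖ 0 = 1
  even : ∀ z, ϖ (-z) = ϖ z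
  real : ∀ z, conj (ϖ z) = ϖ z

/-! ### Energies -/

/-- The expectation value `⟨φ, A φ⟩`. -/
def expect (A : Module.End ℂ 𝓢(ℝ, ℂ)) (φ : 𝓢(ℝ, ℂ)) : ℂ := inner ℂ (vec φ) (vec (A φ))

/-- `m` is the minimum `min A` of the operator `A`, i.e. the bottom of `A`: the expectation values
in normalised states are real and `m` is their infimum. -/
def IsMinOf (A : Module.End ℂ 𝓢(ℝ, ℂ)) (m : ℝ) : Prop :=
  (∀ φ, (expect A φ).im = 0) ∧
    IsGLB {r : ℝ | ∃ φ : 𝓢(ℝ, ℂ), ‖vec φ‖ = 1 ∧ (expect A φ).re = r} m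

/-- `E` is the ground state energy of `A`: it is the minimum of `A`, and it is an eigenvalue. -/
def IsGroundStateEnergy (A : Module.End ℂ 𝓢(ℝ, ℂ)) (E : ℝ) : Prop :=
  IsMinOf A E ∧ A.HasEigenvalue (E : ℂ)

end IntegralQuantization

end

open IntegralQuantization

/-! By the Weyl relation, conjugating `D w` by `D z` only multiplies it by a symplectic phase. Hence
`z ↦ ⟨φ, M(z) ψ⟩` is, up to a rotation and a dilation, the Fourier transform of `h(w) = ϖ(w) ⟨φ,
D(w) ψ⟩ / π` (`inner_displaced`). Quantizing a quadratic function therefore computes second moments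
of a Fourier transform, and these are second derivatives of `h` at the origin.

Since `h` is only integrable and `C²` near `0`, Fourier inversion does not apply to it directly. It
is split as `h = g + R` with `g` Schwartz and having the same 2-jet. Inversion handles `g`, while `R
= o(‖w‖²)` contributes nothing in the limit (`tendsto_integral_schwartz_of_isLittleO`,
`hasOscIntegral_inner_sq_mul_fourier`).

The Leibniz rule separates the derivatives of `ϖ` from those of the matrix element, which produce
`P` and `Q` (`hasFDerivAt_matEl`). This gives `isQuantization_re_sq` and `isQuantization_im_sq`, and
the rest of the quantization formulas is algebra.

For a regular weight the first derivatives vanish and the second ones are real. All three operators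
then have the form `B†B + m` with `B = a, Q, P`. The bottom is `m`: it is attained on the Gaussian
for `a`, and approached by dilations for `Q` and `P` (`isMinOf_mul_add_smul`). -/

noncomputable section

namespace IntegralQuantization

open Asymptotics FourierTransform LineDeriv

/-! ### Second-order jets and their Schwartz representatives -/

section Taylor

variable {E F : Type*} [NormedAddCommGroup E] [NormedSpace ℝ E] [NormedAddCommGroup F]
  [NormedSpace ℝ F]

/-- A `C²` function whose `2`-jet vanishes at the origin is `o(‖x‖²)`. -/
theorem isLittleO_norm_sq_of_jet_eq_zero {f : E → F} (hf : ContDiffAt ℝ 2 f 0) (h0 : f 0 = 0)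
    (h1 : fderiv ℝ f 0 = 0) (h2 : fderiv ℝ (fderiv ℝ f) 0 = 0) :
    f =o[𝓝 0] fun x => ‖x‖ ^ 2 := by
  have hd : ∀ᶠ x in 𝓝 (0 : E), DifferentiableAt ℝ f x :=
    (hf.eventually (by simp)).mono fun x hx => hx.differentiableAt (by simp)
  obtain ⟨r, hr, hball⟩ := Metric.eventually_nhds_iff_ball.1 hd
  have hs : Metric.ball (0 : E) r ∈ 𝓝 (0 : E) := Metric.ball_mem_nhds _ hr
  have hd2 : HasFDerivAt (fderiv ℝ f) (0 : E →L[ℝ] E →L[ℝ] F) 0 := by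
    rw [← h2]
    exact ((hf.fderiv_right (m := 1) (by norm_num)).differentiableAt (by simp)).hasFDerivAt
  have ho : (fderiv ℝ f) =o[𝓝[Metric.ball (0 : E) r] 0] fun x => ‖x - 0‖ ^ 1 := by
    have := hd2.isLittleO
    simp only [h1, sub_zero, zero_apply] at this
    simpa using (this.norm_right).mono nhdsWithin_le_nhds
  -- The mean value inequality on a convex ball gains one order: a derivative that is `o(‖x‖)` gives
  -- a function that is `o(‖x‖²)`.
  have := (convex_ball (0 : E) r).isLittleO_pow_succ (Metric.mem_ball_self hr)
    (fun x hx => (hball x hx).hasFDerivAt.hasFDerivWithinAt) ho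
  rw [nhdsWithin_eq_nhds.2 hs] at this
  simpa [h0] using this

/-- The quadratic Taylor polynomial at the origin. -/
def taylorQuad (f : E → F) (x : E) : F :=
  f 0 + fderiv ℝ f 0 x + (2⁻¹ : ℝ) • fderiv ℝ (fderiv ℝ f) 0 x x

theorem contDiff_taylorQuad (f : E → F) {n : WithTop ℕ∞} : ContDiff ℝ n (taylorQuad f) := by
  unfold taylorQuad
  fun_prop

/-- The quadratic term contributes the second derivative once in each slot; symmetry identifies the
two contributions and cancels the factor `1/2`. -/
theorem hasFDerivAt_taylorQuad {f : E → F} (hf : ContDiffAt ℝ 2 f 0) (x : E) :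
    HasFDerivAt (taylorQuad f) (fderiv ℝ f 0 + fderiv ℝ (fderiv ℝ f) 0 x) x := by
  have hs : IsSymmSndFDerivAt ℝ f 0 := hf.isSymmSndFDerivAt (by simp)
  have h := ((hasFDerivAt_const (f 0) x).add (fderiv ℝ f 0).hasFDerivAt).add
    (((fderiv ℝ (fderiv ℝ f) 0).hasFDerivAt.clm_apply (hasFDerivAt_id x)).const_smul (2⁻¹ : ℝ))
  refine h.congr_fderiv ?_
  ext v
  simp [hs.eq v x, ← two_smul ℝ]

theorem fderiv_taylorQuad {f : E → F} (hf : ContDiffAt ℝ 2 f 0) :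
    fderiv ℝ (taylorQuad f) = fun x => fderiv ℝ f 0 + fderiv ℝ (fderiv ℝ f) 0 x :=
  funext fun x => (hasFDerivAt_taylorQuad hf x).fderiv

theorem fderiv_fderiv_taylorQuad {f : E → F} (hf : ContDiffAt ℝ 2 f 0) (x : E) :
    fderiv ℝ (fderiv ℝ (taylorQuad f)) x = fderiv ℝ (fderiv ℝ f) 0 := by
  rw [fderiv_taylorQuad hf]
  exact ((fderiv ℝ (fderiv ℝ f) 0).hasFDerivAt.const_add _).fderiv

/-- Every `2`-jet is the jet of a Schwartz function. -/
theorem exists_schwartz_isLittleO [FiniteDimensional ℝ E] {f : E → F} (hf : ContDiffAt ℝ 2 f 0) :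
    ∃ g : 𝓢(E, F), (fun x => f x - g x) =o[𝓝 0] (fun x => ‖x‖ ^ 2) ∧
      fderiv ℝ (fderiv ℝ g) 0 = fderiv ℝ (fderiv ℝ f) 0 := by
  let b : ContDiffBump (0 : E) := ⟨1, 2, one_pos, one_lt_two⟩
  have hs : HasCompactSupport fun x : E => b x • taylorQuad f x :=
    b.hasCompactSupport.smul_right
  have hd : ContDiff ℝ (⊤ : ℕ∞) fun x : E => b x • taylorQuad f x :=
    b.contDiff.smul (contDiff_taylorQuad f)
  have hb : (hs.toSchwartzMap hd : E → F) =ᶠ[𝓝 0] taylorQuad f := by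
    filter_upwards [b.eventuallyEq_one] with x hx
    change b x • taylorQuad f x = _
    rw [hx, Pi.one_apply, one_smul]
  refine ⟨hs.toSchwartzMap hd, ?_, ?_⟩
  · have hT := contDiff_taylorQuad f (n := 2)
    have hdf : ∀ᶠ x in 𝓝 (0 : E), DifferentiableAt ℝ f x :=
      (hf.eventually (by simp)).mono fun x hx => hx.differentiableAt (by simp)
    have h1 : fderiv ℝ (f - taylorQuad f) =ᶠ[𝓝 0] fderiv ℝ f - fderiv ℝ (taylorQuad f) := by
      filter_upwards [hdf] with x hx
      rw [fderiv_sub hx (hT.differentiable (by simp)).differentiableAt, Pi.sub_apply]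
    have h : (f - taylorQuad f) =o[𝓝 0] fun x => ‖x‖ ^ 2 := by
      refine isLittleO_norm_sq_of_jet_eq_zero (hf.sub hT.contDiffAt) ?_ ?_ ?_
      · simp [taylorQuad]
      · rw [h1.eq_of_nhds, Pi.sub_apply, fderiv_taylorQuad hf]
        simp
      · rw [h1.fderiv_eq, fderiv_sub
          ((hf.fderiv_right (m := 1) (by norm_num)).differentiableAt (by simp))
          ((hT.fderiv_right (m := 1) (by norm_num)).differentiable (by simp)).differentiableAt,
          fderiv_fderiv_taylorQuad hf, sub_self]
    refine h.congr' ?_ EventuallyEq.rfl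
    filter_upwards [hb] with x hx
    rw [hx, Pi.sub_apply]
  · rw [hb.fderiv.fderiv_eq, fderiv_fderiv_taylorQuad hf]

end Taylor

/-! ### Concentrating Schwartz kernels against a small remainder -/

section Remainder

theorem schwartz_inv_smul_bound (k : 𝓢(ℂ, ℂ)) (n : ℕ) : ∃ C : ℝ, 0 ≤ C ∧
    ∀ (ε : ℝ) (w : ℂ), 0 < ε → ‖w‖ ^ n * ‖k (ε⁻¹ • w)‖ ≤ C * ε ^ n := by
  refine ⟨SchwartzMap.seminorm ℝ n 0 k, apply_nonneg _ _, fun ε w hε => ?_⟩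
  have h := k.norm_pow_mul_le_seminorm ℝ n (ε⁻¹ • w)
  rw [norm_smul, Real.norm_of_nonneg (by positivity), mul_pow, inv_pow] at h
  calc ‖w‖ ^ n * ‖k (ε⁻¹ • w)‖ = ((ε ^ n)⁻¹ * ‖w‖ ^ n * ‖k (ε⁻¹ • w)‖) * ε ^ n := by
        field_simp
    _ ≤ _ := by gcongr

/-- A Schwartz approximate identity tests a function that is `o(‖w‖²)` to order `o(ε⁴)`. -/
theorem tendsto_integral_schwartz_of_isLittleO (k : 𝓢(ℂ, ℂ)) {R : ℂ → ℂ} (hR : Integrable R)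
    (ho : R =o[𝓝 0] fun w => ‖w‖ ^ 2) :
    Tendsto (fun ε : ℝ => (ε ^ 4)⁻¹ • ∫ w, k (ε⁻¹ • w) * R w) (𝓝[>] 0) (𝓝 0) := by
  -- Away from the origin the kernel must beat the prefactor `ε⁻⁴`; decay of order 6 leaves `ε²`.
  obtain ⟨C, hC0, hC⟩ := schwartz_inv_smul_bound k 6
  set A : ℝ := ∫ w, ‖w‖ ^ 2 * ‖k w‖ with hA
  have hA0 : 0 ≤ A := integral_nonneg fun w => by positivity
  set B : ℝ := ∫ w, ‖R w‖ with hB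
  have hB0 : 0 ≤ B := integral_nonneg fun w => by positivity
  have key : ∀ η > 0, ∃ K : ℝ, ∀ ε > 0,
      ‖(ε ^ 4)⁻¹ • ∫ w, k (ε⁻¹ • w) * R w‖ ≤ η * A + K * ε ^ 2 := by
    intro η hη
    obtain ⟨δ, hδ, hδR⟩ := Metric.eventually_nhds_iff_ball.1 (ho.def hη)
    refine ⟨C / δ ^ 6 * B, fun ε hε => ?_⟩
    have hi1 : Integrable fun w : ℂ => ‖ε⁻¹ • w‖ ^ 2 * ‖k (ε⁻¹ • w)‖ :=
      (k.integrable_pow_mul volume 2).comp_smul (inv_ne_zero hε.ne')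
    -- The first term serves inside the `δ`-ball, where `‖R w‖ ≤ η ‖w‖²`, and the second outside it.
    -- Rescaling turns the integral of the first into `η ε⁴ A`: one `ε²` from `‖w‖²`, one from the
    -- area element.
    have hbound : ∀ w, ‖k (ε⁻¹ • w) * R w‖ ≤
        (η * ε ^ 2) * (‖ε⁻¹ • w‖ ^ 2 * ‖k (ε⁻¹ • w)‖) + (C / δ ^ 6 * ε ^ 6) * ‖R w‖ := by
      intro w
      rw [norm_mul]
      have e1 : (η * ε ^ 2) * (‖ε⁻¹ • w‖ ^ 2 * ‖k (ε⁻¹ • w)‖) =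
          ‖k (ε⁻¹ • w)‖ * (η * ‖w‖ ^ 2) := by
        rw [norm_smul, Real.norm_of_nonneg (by positivity)]
        field_simp
      by_cases hw : w ∈ Metric.ball (0 : ℂ) δ
      · have h := hδR w hw
        rw [norm_pow, norm_norm] at h
        refine le_trans ?_ (le_add_of_nonneg_right (by positivity))
        rw [e1]
        gcongr
      · refine le_trans ?_ (le_add_of_nonneg_left (by positivity))
        gcongr
        have hw' : δ ≤ ‖w‖ := by simpa using hw
        have h6 : δ ^ 6 * ‖k (ε⁻¹ • w)‖ ≤ C * ε ^ 6 :=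
          le_trans (by gcongr) (hC ε w hε)
        rw [div_mul_eq_mul_div, le_div_iff₀ (by positivity)]
        linarith
    have hint := norm_integral_le_of_norm_le
      ((hi1.const_mul _).add (hR.norm.const_mul (C / δ ^ 6 * ε ^ 6)))
      (Eventually.of_forall hbound)
    simp only [Pi.add_apply] at hint
    rw [integral_add (hi1.const_mul _) (hR.norm.const_mul _), integral_const_mul,
      integral_const_mul, Measure.integral_comp_smul volume (fun w : ℂ => ‖w‖ ^ 2 * ‖k w‖),
      Complex.finrank_real_complex, ← hA, ← hB] at hint
    rw [norm_smul, Real.norm_of_nonneg (by positivity)]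
    calc (ε ^ 4)⁻¹ * ‖∫ w, k (ε⁻¹ • w) * R w‖
        ≤ (ε ^ 4)⁻¹ * ((η * ε ^ 2) * (|(ε⁻¹ ^ 2)⁻¹| • A) + (C / δ ^ 6 * ε ^ 6) * B) := by
          gcongr
      _ = _ := by
          rw [abs_of_pos (by positivity), smul_eq_mul]
          field_simp
  rw [Metric.tendsto_nhds]
  intro η hη
  -- The `+ 1` keeps the denominator positive even if `A = 0`.
  obtain ⟨K, hK⟩ := key (η / (2 * (A + 1))) (by positivity)
  have hlim : Tendsto (fun ε : ℝ => K * ε ^ 2) (𝓝[>] 0) (𝓝 0) := by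
    have : Continuous fun ε : ℝ => K * ε ^ 2 := by fun_prop
    simpa using (this.tendsto 0).mono_left (nhdsWithin_le_nhds (s := Set.Ioi 0))
  filter_upwards [hlim.eventually_lt_const (half_pos hη), self_mem_nhdsWithin] with ε h1 hε
  rw [dist_zero_right]
  have h2 : η / (2 * (A + 1)) * A ≤ η / 2 := by
    rw [div_mul_eq_mul_div, div_le_div_iff₀ (by positivity) two_pos]
    nlinarith
  linarith [hK ε hε]

end Remainder

/-! ### Oscillatory second moments of Fourier transforms -/

section Oscillatory

theorem HasOscIntegral.add {F G : ℂ → ℂ} {L L' : ℂ} (hF : HasOscIntegral F L)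
    (hG : HasOscIntegral G L') : HasOscIntegral (fun z => F z + G z) (L + L') := by
  intro χ hχ
  have h (ε : ℝ) (hε : 0 < ε) := ((hF χ hχ).1 ε hε).add ((hG χ hχ).1 ε hε)
  simp only [mul_add]
  refine ⟨h, ((hF χ hχ).2.add (hG χ hχ).2).congr' ?_⟩
  filter_upwards [self_mem_nhdsWithin] with ε hε
  exact (integral_add ((hF χ hχ).1 ε hε) ((hG χ hχ).1 ε hε)).symm

theorem HasOscIntegral.const_mul {F : ℂ → ℂ} {L : ℂ} (hF : HasOscIntegral F L) (c : ℂ) :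
    HasOscIntegral (fun z => c * F z) (c * L) := by
  intro χ hχ
  simp only [mul_left_comm _ c]
  refine ⟨fun ε hε => ((hF χ hχ).1 ε hε).const_mul c, ?_⟩
  simp only [integral_const_mul]
  exact (hF χ hχ).2.const_mul c

/-- Dilation of Schwartz functions on the plane. -/
def dilation (c : ℝ) (hc : c ≠ 0) (κ : 𝓢(ℂ, ℂ)) : 𝓢(ℂ, ℂ) :=
  compCLMOfContinuousLinearEquiv ℂ (ContinuousLinearEquiv.smulLeft (Units.mk0 c hc)) κ

theorem dilation_apply (c : ℝ) (hc : c ≠ 0) (κ : 𝓢(ℂ, ℂ)) (z : ℂ) :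
    dilation c hc κ z = κ (c • z) := rfl

/-- Dilations in an oscillatory integral. -/
theorem HasOscIntegral.comp_smul {F : ℂ → ℂ} {L : ℂ} (hF : HasOscIntegral F L) {c : ℝ}
    (hc : 0 < c) : HasOscIntegral (fun z => F (c • z)) ((c ^ 2)⁻¹ • L) := by
  intro χ hχ
  -- The dilation is absorbed into the cut-off, whose value at `0` is unchanged.
  have h (ε : ℝ) (z : ℂ) : χ (ε • z) * F (c • z) =
      (fun y => dilation c⁻¹ (inv_ne_zero hc.ne') χ (ε • y) * F y) (c • z) := by
    simp only [dilation_apply]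
    rw [smul_comm ε c, inv_smul_smul₀ hc.ne']
  have hF' := hF (dilation c⁻¹ (inv_ne_zero hc.ne') χ) (by rwa [dilation_apply, smul_zero])
  simp only [h]
  refine ⟨fun ε hε => (hF'.1 ε hε).comp_smul hc.ne', ?_⟩
  refine (hF'.2.const_smul (c ^ 2)⁻¹).congr fun ε => ?_
  rw [Measure.integral_comp_smul volume
    (fun y : ℂ => dilation c⁻¹ (inv_ne_zero hc.ne') χ (ε • y) * F y),
    Complex.finrank_real_complex, abs_of_pos (by positivity)]

/-- Isometries in an oscillatory integral. -/
theorem HasOscIntegral.comp_linearIsometryEquiv {F : ℂ → ℂ} {L : ℂ} (hF : HasOscIntegral F L)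
    (e : ℂ ≃ₗᵢ[ℝ] ℂ) : HasOscIntegral (fun z => F (e z)) L := by
  intro χ hχ
  have hm := e.measurePreserving
  have he := e.toHomeomorph.measurableEmbedding
  let χ' : 𝓢(ℂ, ℂ) := compCLMOfContinuousLinearEquiv ℂ e.symm.toContinuousLinearEquiv χ
  have h (ε : ℝ) (z : ℂ) : χ (ε • z) * F (e z) = (fun y => χ' (ε • y) * F y) (e z) := by
    change _ = χ (e.symm (ε • e z)) * _
    rw [map_smul e.symm, e.symm_apply_apply]
  have hF' := hF χ' (by change χ (e.symm 0) = 1; rwa [map_zero])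
  simp only [h]
  refine ⟨fun ε hε => (hm.integrable_comp_emb he).2 (hF'.1 ε hε), ?_⟩
  exact hF'.2.congr fun ε => (hm.integral_comp he (fun y => χ' (ε • y) * F y)).symm

/-- For a Schwartz function the oscillatory integral of the second moment of the Fourier transform
is computed by Fourier inversion. -/
theorem hasOscIntegral_inner_sq_mul_fourier_schwartz (g : 𝓢(ℂ, ℂ)) (u : ℂ) :
    HasOscIntegral (fun z : ℂ => ((inner ℝ z u : ℝ) : ℂ) ^ 2 * 𝓕 (g : ℂ → ℂ) z)
      (-(4 * (Real.pi : ℂ) ^ 2)⁻¹ * fderiv ℝ (fderiv ℝ g) 0 u u) := by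
  have hg : (inner ℝ · u : ℂ → ℝ).HasTemperateGrowth := by fun_prop
  have hf (z : ℂ) : 𝓕 (∂_{u} (∂_{u} g)) z =
      -(4 * (Real.pi : ℂ) ^ 2) * (((inner ℝ z u : ℝ) : ℂ) ^ 2 * 𝓕 (g : ℂ → ℂ) z) := by
    rw [fourier_lineDerivOp_eq, fourier_lineDerivOp_eq, ← fourier_coe]
    simp only [smul_apply, smulLeftCLM_apply_apply hg, smul_eq_mul, Complex.real_smul]
    ring_nf
    simp
  have h2 : (fun z : ℂ => ((inner ℝ z u : ℝ) : ℂ) ^ 2 * 𝓕 (g : ℂ → ℂ) z) =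
      fun z => -(4 * (Real.pi : ℂ) ^ 2)⁻¹ * 𝓕 (∂_{u} (∂_{u} g)) z := by
    ext z
    have : (Real.pi : ℂ) ≠ 0 := by exact_mod_cast Real.pi_ne_zero
    rw [hf]
    field_simp
  -- The integral of a Fourier transform is the inverse transform of it at the origin.
  have h3 : ∫ z, 𝓕 (∂_{u} (∂_{u} g)) z = fderiv ℝ (fderiv ℝ g) 0 u u := by
    have h : 𝓕⁻ (𝓕 (∂_{u} (∂_{u} g))) (0 : ℂ) = (∂_{u} (∂_{u} g)) 0 := by
      rw [FourierTransform.fourierInv_fourier_eq]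
    rw [fourierInv_coe, Real.fourierInv_eq] at h
    simp only [inner_zero_right, AddChar.map_zero_eq_one, one_smul] at h
    rw [h, lineDerivOp_apply_eq_fderiv]
    have : ((∂_{u} g : 𝓢(ℂ, ℂ)) : ℂ → ℂ) = fun w => fderiv ℝ g w u :=
      funext fun w => lineDerivOp_apply_eq_fderiv u g w
    rw [this]
    have hd : DifferentiableAt ℝ (fderiv ℝ g) 0 :=
      (((g.smooth 2).fderiv_right (m := 1) (by norm_num)).differentiable (by simp)).differentiableAt
    rw [fderiv_clm_apply hd (differentiableAt_const u)]
    simp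
  rw [h2, ← h3, ← integral_const_mul]
  exact hasOscIntegral_integral ((𝓕 (∂_{u} (∂_{u} g))).integrable.const_mul _)

/-- Moving the transform onto the Schwartz factor leaves a function `f` of which only integrability
is required. -/
theorem integral_schwartz_mul_fourier (κ : 𝓢(ℂ, ℂ)) {f : ℂ → ℂ} (hf : Integrable f) :
    ∫ z, κ z * 𝓕 f z = ∫ w, 𝓕 κ w * f w := by
  simpa [fourier_coe] using! (VectorFourier.integral_bilin_fourierIntegral_eq_flip
    (.mul ℂ ℂ) (L := innerₗ ℂ) Real.continuous_fourierChar continuous_inner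
    κ.integrable hf).symm

theorem continuous_fourier_of_integrable {f : ℂ → ℂ} (hf : Integrable f) : Continuous (𝓕 f) :=
  VectorFourier.fourierIntegral_continuous Real.continuous_fourierChar continuous_inner hf

theorem integrable_schwartz_mul_fourier (κ : 𝓢(ℂ, ℂ)) {f : ℂ → ℂ} (hf : Integrable f) :
    Integrable fun z => κ z * 𝓕 f z :=
  κ.integrable.mul_bdd (c := ∫ v, ‖f v‖) (continuous_fourier_of_integrable hf).aestronglyMeasurable
    (Eventually.of_forall fun _ => VectorFourier.norm_fourierIntegral_le_integral_norm _ _ _ _ _)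

theorem fourier_dilation (c : ℝ) (hc : 0 < c) (κ : 𝓢(ℂ, ℂ)) (w : ℂ) :
    𝓕 (dilation c hc.ne' κ) w = (c ^ 2)⁻¹ • 𝓕 κ (c⁻¹ • w) := by
  rw [fourier_coe, fourier_coe, Real.fourier_eq, Real.fourier_eq]
  have h := Measure.integral_comp_smul volume
    (fun v : ℂ => Real.fourierChar (-inner ℝ v (c⁻¹ • w)) • κ v) c
  rw [Complex.finrank_real_complex, abs_of_pos (by positivity)] at h
  rw [← h]
  congr 1 with v
  rw [dilation_apply, real_inner_smul_left, real_inner_smul_right, mul_inv_cancel_left₀ hc.ne']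

/-- The quadratic factor is absorbed into the cut-off: with `κ(z) = ⟨z, u⟩² χ(z)`, the integrand is
`ε⁻² κ(εz) 𝓕 f(z)`. Passing the transform to `κ(ε ·)` yields another `ε⁻²` and the kernel `𝓕
κ(w/ε)`, so the total is exactly the `ε⁻⁴` of `tendsto_integral_schwartz_of_isLittleO`. -/
theorem hasOscIntegral_inner_sq_mul_fourier_of_isLittleO {f : ℂ → ℂ} (hf : Integrable f)
    (ho : f =o[𝓝 0] fun w => ‖w‖ ^ 2) (u : ℂ) :
    HasOscIntegral (fun z : ℂ => ((inner ℝ z u : ℝ) : ℂ) ^ 2 * 𝓕 f z) 0 := by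
  intro χ _
  have hg : (fun z : ℂ => ((inner ℝ z u : ℝ) : ℂ) ^ 2).HasTemperateGrowth := by
    have h : (inner ℝ · u : ℂ → ℝ).HasTemperateGrowth := by fun_prop
    exact (Complex.ofRealCLM.hasTemperateGrowth.comp h).pow 2
  let κ : 𝓢(ℂ, ℂ) := smulLeftCLM ℂ (fun z : ℂ => ((inner ℝ z u : ℝ) : ℂ) ^ 2) χ
  have hκ (ε : ℝ) (hε : 0 < ε) (z : ℂ) :
      χ (ε • z) * (((inner ℝ z u : ℝ) : ℂ) ^ 2 * 𝓕 f z) =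
        (ε ^ 2)⁻¹ • (dilation ε hε.ne' κ z * 𝓕 f z) := by
    rw [dilation_apply, smulLeftCLM_apply_apply hg, real_inner_smul_left, smul_eq_mul,
      Complex.real_smul (x := (ε ^ 2)⁻¹)]
    have : (ε : ℂ) ≠ 0 := by exact_mod_cast hε.ne'
    push_cast
    field_simp
  refine ⟨fun ε hε => ?_, ?_⟩
  · simp only [hκ ε hε]
    exact (integrable_schwartz_mul_fourier _ hf).smul (ε ^ 2)⁻¹
  · refine (tendsto_integral_schwartz_of_isLittleO (𝓕 κ) hf ho).congr' ?_
    filter_upwards [self_mem_nhdsWithin] with ε hε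
    replace hε : 0 < ε := hε
    simp only [hκ ε hε]
    rw [integral_smul, integral_schwartz_mul_fourier _ hf]
    simp only [fourier_dilation ε hε, smul_mul_assoc]
    rw [integral_smul, smul_smul]
    congr 1
    field_simp

/-- The second moments of the Fourier transform of a function that is `C²` near the origin, as
oscillatory integrals. -/
theorem hasOscIntegral_inner_sq_mul_fourier {h : ℂ → ℂ} (hi : Integrable h)
    (hc : ContDiffAt ℝ 2 h 0) (u : ℂ) :
    HasOscIntegral (fun z : ℂ => ((inner ℝ z u : ℝ) : ℂ) ^ 2 * 𝓕 h z)
      (-(4 * (Real.pi : ℂ) ^ 2)⁻¹ * fderiv ℝ (fderiv ℝ h) 0 u u) := by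
  obtain ⟨g, ho, hg⟩ := exists_schwartz_isLittleO hc
  have hR : Integrable (h - (g : ℂ → ℂ)) := hi.sub g.integrable
  have hsum := (hasOscIntegral_inner_sq_mul_fourier_schwartz g u).add
    (hasOscIntegral_inner_sq_mul_fourier_of_isLittleO hR ho u)
  rw [add_zero, hg] at hsum
  convert hsum using 2 with z
  rw [← mul_add]
  congr 1
  rw [Real.fourier_eq, Real.fourier_eq, Real.fourier_eq, ← integral_add]
  · congr 1 with v
    rw [← smul_add, Pi.sub_apply, add_sub_cancel]
  · exact (Real.fourierIntegral_convergent_iff z).2 g.integrable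
  · exact (Real.fourierIntegral_convergent_iff z).2 hR

end Oscillatory

/-! ### Weyl relations and the symplectic Fourier transform -/

section Displacement

/-- Plane waves, with a constant phase, have temperate growth. -/
theorem hasTemperateGrowth_planeWave (p s : ℝ) :
    (fun x : ℝ => Complex.exp (Complex.I * ((p * (x - s) : ℝ) : ℂ))).HasTemperateGrowth := by
  set e : ℝ → ℂ := fun x => Complex.exp (Complex.I * ((p * (x - s) : ℝ) : ℂ)) with he
  have hd (x : ℝ) : HasDerivAt e (Complex.I * p * e x) x := by
    have h1 : HasDerivAt (fun x : ℝ => ((p * (x - s) : ℝ) : ℂ)) ((p * 1 : ℝ) : ℂ) x :=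
      (((hasDerivAt_id x).sub_const s).const_mul p).ofReal_comp
    convert (h1.const_mul Complex.I).cexp using 1
    rw [he]
    push_cast
    ring
  have hn (n : ℕ) : iteratedDeriv n e = fun x => (Complex.I * p) ^ n * e x := by
    induction n with
    | zero => ext x; simp
    | succ n ih =>
      rw [iteratedDeriv_succ, ih]
      ext x
      rw [((hd x).const_mul _).deriv]
      ring
  have hsm : ContDiff ℝ (⊤ : ℕ∞) e :=
    Complex.contDiff_exp.comp (contDiff_const.mul 
      (Complex.ofRealCLM.contDiff.comp (contDiff_const.mul (contDiff_id.sub contDiff_const))))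
  refine ⟨hsm, fun n => ⟨0, |p| ^ n, fun x => ?_⟩⟩
  rw [norm_iteratedFDeriv_eq_norm_iteratedDeriv, hn]
  change ‖(Complex.I * p) ^ n * Complex.exp (Complex.I * _)‖ ≤ _
  rw [norm_mul, mul_comm Complex.I (Complex.ofReal (p * (x - s))), Complex.norm_exp_ofReal_mul_I]
  simp

/-- The displacement operator on the Schwartz space. -/
def displaceS (z : ℂ) (φ : 𝓢(ℝ, ℂ)) : 𝓢(ℝ, ℂ) :=
  smulLeftCLM ℂ (fun x : ℝ => Complex.exp (Complex.I * ((pOf z * (x - qOf z / 2) : ℝ) : ℂ)))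
    (compSubConstCLM ℂ (qOf z) φ)

theorem displaceS_apply (z : ℂ) (φ : 𝓢(ℝ, ℂ)) (x : ℝ) :
    displaceS z φ x = displaceFun z φ x := by
  rw [displaceS, smulLeftCLM_apply_apply (hasTemperateGrowth_planeWave _ _),
    compSubConstCLM_apply, smul_eq_mul, displaceFun]

theorem D_vec (z : ℂ) (φ : 𝓢(ℝ, ℂ)) : D z (vec φ) = vec (displaceS z φ) := by
  refine Lp.ext ?_
  filter_upwards [coeFn_D z (vec φ), displaceFun_congr z (φ.coeFn_toLp 2 volume),
    (displaceS z φ).coeFn_toLp 2 volume] with x h1 h2 h3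
  rw [h1, h2, h3, displaceS_apply]

theorem qOf_neg (z : ℂ) : qOf (-z) = -qOf z := by simp [qOf]

theorem pOf_neg (z : ℂ) : pOf (-z) = -pOf z := by simp [pOf]

theorem displaceFun_displaceFun_neg (z : ℂ) (φ : ℝ → ℂ) :
    displaceFun z (displaceFun (-z) φ) = φ := by
  ext x
  simp only [displaceFun, qOf_neg, pOf_neg]
  rw [← mul_assoc, ← Complex.exp_add, ← mul_add, ← Complex.ofReal_add]
  ring_nf
  simp

theorem D_D_neg (z : ℂ) (φ : Hilb) : D z (D (-z) φ) = φ := by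
  refine Lp.ext ?_
  filter_upwards [coeFn_D z (D (-z) φ), displaceFun_congr z (coeFn_D (-z) φ)] with x h1 h2
  rw [h1, h2, displaceFun_displaceFun_neg]

theorem inner_D_D (z : ℂ) (φ ψ : Hilb) : inner ℂ (D z φ) (D z ψ) = inner ℂ φ ψ :=
  (displacement z).inner_map_map φ ψ

theorem adjoint_D (z : ℂ) : ContinuousLinearMap.adjoint (D z) = D (-z) := by
  refine (ContinuousLinearMap.eq_adjoint_iff _ _ |>.2 fun φ ψ => ?_).symm
  rw [← inner_D_D z, D_D_neg]

/-- Both sides translate by the same amount, so only phases are compared. They differ by the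
symplectic form of `z` and `w`, the factor 2 being `√2 · √2` from the normalisation of `q` and `p`.
-/
theorem displaceFun_comm (w z : ℂ) (φ : ℝ → ℂ) (x : ℝ) :
    displaceFun w (displaceFun (-z) φ) x =
      Complex.exp ((2 * (z.im * w.re - z.re * w.im) : ℝ) * Complex.I) *
        displaceFun (-z) (displaceFun w φ) x := by
  have h : (√2 : ℝ) * √2 = 2 := Real.mul_self_sqrt (by norm_num)
  have hx : x - qOf w - qOf (-z) = x - qOf (-z) - qOf w := by ring
  simp only [displaceFun, hx]
  rw [← mul_assoc, ← mul_assoc, ← mul_assoc, ← Complex.exp_add, ← Complex.exp_add,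
    ← Complex.exp_add]
  congr 2
  rw [mul_comm _ Complex.I, ← mul_add, ← mul_add, ← mul_add, ← Complex.ofReal_add,
    ← Complex.ofReal_add, ← Complex.ofReal_add]
  congr 2
  simp only [qOf, pOf, Complex.neg_re, Complex.neg_im]
  linear_combination (z.im * w.re - z.re * w.im) * h

theorem D_comm (w z : ℂ) (φ : Hilb) :
    D w (D (-z) φ) =
      Complex.exp ((2 * (z.im * w.re - z.re * w.im) : ℝ) * Complex.I) • D (-z) (D w φ) := by
  refine Lp.ext ?_
  filter_upwards [coeFn_D w (D (-z) φ), displaceFun_congr w (coeFn_D (-z) φ),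
    coeFn_D (-z) (D w φ), displaceFun_congr (-z) (coeFn_D w φ),
    Lp.coeFn_smul (Complex.exp ((2 * (z.im * w.re - z.re * w.im) : ℝ) * Complex.I))
      (D (-z) (D w φ))] with x h1 h2 h3 h4 h5
  rw [h1, h2, h5, Pi.smul_apply, h3, h4, displaceFun_comm, smul_eq_mul]

/-- The matrix element `w ↦ ⟨φ, D(w) ψ⟩`. -/
def matEl (φ ψ : 𝓢(ℝ, ℂ)) (w : ℂ) : ℂ := inner ℂ (vec φ) (D w (vec ψ))

/-- The matrix elements of the displaced operator are a symplectic Fourier transform. -/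
theorem inner_displaced {ϖ : ℂ → ℂ} {M : Hilb →L[ℂ] Hilb} (hM : IsWeightOperator ϖ M)
    (φ ψ : 𝓢(ℝ, ℂ)) (z : ℂ) :
    inner ℂ (vec φ) (displaced M z (vec ψ)) =
      𝓕 (fun w => ϖ w * matEl φ ψ w / Real.pi) (Real.pi⁻¹ • (Complex.I * z)) := by
  rw [displaced, adjoint_D]
  simp only [ContinuousLinearMap.comp_apply]
  rw [← ContinuousLinearMap.adjoint_inner_left, adjoint_D, D_vec, D_vec, (hM _ _).2,
    Real.fourier_eq']
  congr 1 with w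
  rw [← D_vec, ← D_vec, D_comm, inner_smul_right, inner_D_D, smul_eq_mul, matEl]
  -- The argument `π⁻¹ • (i z)` is chosen so that the Fourier phase `-2π⟨w, ·⟩` becomes the
  -- symplectic phase.
  have : -2 * Real.pi * inner ℝ w (Real.pi⁻¹ • (Complex.I * z)) =
      2 * (z.im * w.re - z.re * w.im) := by
    rw [real_inner_smul_right, Complex.inner]
    simp
    field_simp
    ring
  rw [this]
  ring

end Displacement

/-! ### Smoothness of the matrix elements of the displacement operators -/

section MatrixElements

theorem matEl_eq_integral (φ ψ : 𝓢(ℝ, ℂ)) (w : ℂ) :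
    matEl φ ψ w = ∫ x, conj (φ x) * displaceFun w ψ x := by
  rw [matEl, D_vec]
  refine (inner_toL2_toL2_eq φ (displaceS w ψ) volume).trans ?_
  simp only [RCLike.inner_apply, displaceS_apply, mul_comm]

theorem matEl_zero (φ ψ : 𝓢(ℝ, ℂ)) : matEl φ ψ 0 = inner ℂ (vec φ) (vec ψ) := by
  rw [matEl, D_vec]
  congr 2
  ext x
  simp [displaceS_apply, displaceFun, pOf, qOf]

theorem continuous_displaceFun (w : ℂ) (ψ : 𝓢(ℝ, ℂ)) : Continuous (displaceFun w ψ) := by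
  exact (displaceS w ψ).continuous.congr fun x => displaceS_apply w ψ x

theorem norm_displaceFun_le (w : ℂ) (ψ : 𝓢(ℝ, ℂ)) (x : ℝ) :
    ‖displaceFun w ψ x‖ ≤ SchwartzMap.seminorm ℝ 0 0 ψ := by
  rw [norm_displaceFun]
  exact ψ.norm_le_seminorm ℝ _

theorem integrable_conj_mul_displaceFun (φ ψ : 𝓢(ℝ, ℂ)) (w : ℂ) :
    Integrable fun x => conj (φ x) * displaceFun w ψ x :=
  (Complex.conjCLE.integrable_comp_iff.2 φ.integrable).mul_bdd
    (continuous_displaceFun w ψ).aestronglyMeasurable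
    (Eventually.of_forall (norm_displaceFun_le w ψ))

/-- Writing `x = (x - q) + q` puts the factor `x` inside the displacement as `opQ`, and `ψ'` becomes
`opP`. The derivative is thus built from displaced Schwartz functions, which makes the formula
iterable; the terms in `w.re` and `w.im` come from the half-shift `q/2` in the phase. -/
theorem hasFDerivAt_displaceFun (ψ : 𝓢(ℝ, ℂ)) (x : ℝ) (w : ℂ) :
    HasFDerivAt (fun w => displaceFun w ψ x)
      (Complex.reCLM.smulRight (-Complex.I *
          (√2 * displaceFun w (opP ψ) x + w.im * displaceFun w ψ x)) +
        Complex.imCLM.smulRight (Complex.I *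
          (√2 * displaceFun w (opQ ψ) x + w.re * displaceFun w ψ x))) w := by
  have h : (√2 : ℝ) * √2 = 2 := Real.mul_self_sqrt (by norm_num)
  have hq : HasFDerivAt qOf ((√2 : ℝ) • Complex.reCLM) w :=
    Complex.reCLM.hasFDerivAt.const_smul (√2 : ℝ)
  have hp : HasFDerivAt pOf ((√2 : ℝ) • Complex.imCLM) w :=
    Complex.imCLM.hasFDerivAt.const_smul (√2 : ℝ)
  have h1 : HasFDerivAt (fun w => ((pOf w * (x - qOf w / 2) : ℝ) : ℂ)) _ w :=
    Complex.ofRealCLM.hasFDerivAt.comp w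
      (hp.mul ((hasFDerivAt_const x w).sub (hq.mul_const (2⁻¹ : ℝ))))
  have h2 := (h1.const_mul Complex.I).cexp
  have h3 : HasFDerivAt (fun w => ψ (x - qOf w)) _ w :=
    HasFDerivAt.comp (g := ψ) w (ψ.hasDerivAt (x - qOf w)).hasFDerivAt
      ((hasFDerivAt_const x w).sub hq)
  have h4 := h2.mul h3
  refine h4.congr_fderiv ?_
  ext v
  simp [displaceFun, opP_apply, opQ_apply]
  generalize Complex.exp (Complex.I * (pOf w * (x - qOf w / 2))) = e
  generalize deriv (ψ : ℝ → ℂ) (x - qOf w) = d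
  generalize ψ (x - qOf w) = y
  have h' : ((√2 : ℝ) : ℂ) * (√2 : ℝ) = 2 := by exact_mod_cast h
  simp only [qOf, pOf, Complex.ofReal_mul]
  linear_combination (-(√2 : ℝ) * e * v.re * d) * Complex.I_mul_I +
    (-y * e * Complex.I * v.re * w.im / 2 + y * e * Complex.I * v.im * w.re / 2) * h'

theorem hasFDerivAt_matEl (φ ψ : 𝓢(ℝ, ℂ)) (w : ℂ) :
    HasFDerivAt (matEl φ ψ)
      (Complex.reCLM.smulRight (-Complex.I * (√2 * matEl φ (opP ψ) w + w.im * matEl φ ψ w)) +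
        Complex.imCLM.smulRight (Complex.I * (√2 * matEl φ (opQ ψ) w + w.re * matEl φ ψ w))) w := by
  set S : 𝓢(ℝ, ℂ) → ℝ := fun ψ => SchwartzMap.seminorm ℝ 0 0 ψ
  let a (w : ℂ) (x : ℝ) : ℂ := conj (φ x) * (-Complex.I *
    (√2 * displaceFun w (opP ψ) x + w.im * displaceFun w ψ x))
  let b (w : ℂ) (x : ℝ) : ℂ := conj (φ x) * (Complex.I *
    (√2 * displaceFun w (opQ ψ) x + w.re * displaceFun w ψ x))
  let F' (w : ℂ) (x : ℝ) : ℂ →L[ℝ] ℂ :=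
    ContinuousLinearMap.smulRightL ℝ ℂ ℂ Complex.reCLM (a w x) +
      ContinuousLinearMap.smulRightL ℝ ℂ ℂ Complex.imCLM (b w x)
  have hia : Integrable (a w) := by
    refine ((((integrable_conj_mul_displaceFun φ (opP ψ) w).const_mul (√2 : ℂ)).add
      ((integrable_conj_mul_displaceFun φ ψ w).const_mul (w.im : ℂ))).const_mul
        (-Complex.I)).congr (Eventually.of_forall fun x => ?_)
    simp only [a, Pi.add_apply]
    ring
  have hib : Integrable (b w) := by
    refine ((((integrable_conj_mul_displaceFun φ (opQ ψ) w).const_mul (√2 : ℂ)).add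
      ((integrable_conj_mul_displaceFun φ ψ w).const_mul (w.re : ℂ))).const_mul
        Complex.I).congr (Eventually.of_forall fun x => ?_)
    simp only [b, Pi.add_apply]
    ring
  have hiF : Integrable (F' w) :=
    ((ContinuousLinearMap.smulRightL ℝ ℂ ℂ Complex.reCLM).integrable_comp hia).add
      ((ContinuousLinearMap.smulRightL ℝ ℂ ℂ Complex.imCLM).integrable_comp hib)
  -- Displacement preserves sup norms, so the integrable function `‖φ x‖` times a constant dominates
  -- the derivative on the unit ball around `w`.
  have hbound : ∀ x, ∀ v ∈ Metric.ball w 1, ‖F' v x‖ ≤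
      ‖φ x‖ * (√2 * S (opP ψ) + (‖w‖ + 1) * S ψ) +
        ‖φ x‖ * (√2 * S (opQ ψ) + (‖w‖ + 1) * S ψ) := by
    intro x v hv
    have hv' : ‖v‖ ≤ ‖w‖ + 1 := by
      have := norm_sub_norm_le v w
      have := (mem_ball_iff_norm.1 hv).le
      linarith
    have hcoord (t : ℝ) (ht : |t| ≤ ‖v‖) (χ : 𝓢(ℝ, ℂ)) :
        ‖(√2 : ℂ) * displaceFun v χ x + t * displaceFun v ψ x‖ ≤
          √2 * S χ + (‖w‖ + 1) * S ψ := by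
      refine (norm_add_le _ _).trans ?_
      rw [norm_mul, norm_mul, Complex.norm_real, Complex.norm_real, Real.norm_eq_abs,
        Real.norm_eq_abs, abs_of_nonneg (Real.sqrt_nonneg 2)]
      gcongr
      · exact norm_displaceFun_le v χ x
      · exact ht.trans hv'
      · exact norm_displaceFun_le v ψ x
    refine (norm_add_le _ _).trans (add_le_add ?_ ?_)
    · change ‖Complex.reCLM.smulRight (a v x)‖ ≤ _
      rw [ContinuousLinearMap.norm_smulRight_apply, Complex.reCLM_norm, one_mul, norm_mul,
        RCLike.norm_conj, norm_mul, norm_neg, Complex.norm_I, one_mul]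
      gcongr
      exact hcoord v.im (Complex.abs_im_le_norm v) _
    · change ‖Complex.imCLM.smulRight (b v x)‖ ≤ _
      rw [ContinuousLinearMap.norm_smulRight_apply, Complex.imCLM_norm, one_mul, norm_mul,
        RCLike.norm_conj, norm_mul, Complex.norm_I, one_mul]
      gcongr
      exact hcoord v.re (Complex.abs_re_le_norm v) _
  have hdiff : ∀ x, ∀ v ∈ Metric.ball w 1,
      HasFDerivAt (fun v => conj (φ x) * displaceFun v ψ x) (F' v x) v := by
    intro x v _
    refine ((hasFDerivAt_displaceFun ψ x v).const_mul (conj (φ x))).congr_fderiv ?_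
    ext u
    simp [F', a, b]
    ring
  have hmain := hasFDerivAt_integral_of_dominated_of_fderiv_le
    (F := fun v x => conj (φ x) * displaceFun v ψ x) (F' := F') (μ := volume) (x₀ := w)
    (Metric.ball_mem_nhds w one_pos)
    (Eventually.of_forall fun v => (integrable_conj_mul_displaceFun φ ψ v).1)
    (integrable_conj_mul_displaceFun φ ψ w) hiF.1 (Eventually.of_forall hbound)
    ((φ.integrable.norm.mul_const _).add (φ.integrable.norm.mul_const _))
    (Eventually.of_forall hdiff)
  have heq : matEl φ ψ = fun v => ∫ x, conj (φ x) * displaceFun v ψ x :=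
    funext (matEl_eq_integral φ ψ)
  have hinta : ∫ x, a w x = -Complex.I * (√2 * matEl φ (opP ψ) w + w.im * matEl φ ψ w) := by
    rw [matEl_eq_integral, matEl_eq_integral, ← integral_const_mul, ← integral_const_mul,
      ← integral_add ((integrable_conj_mul_displaceFun φ (opP ψ) w).const_mul _)
        ((integrable_conj_mul_displaceFun φ ψ w).const_mul _), ← integral_const_mul]
    congr 1 with x
    simp only [a]
    ring
  have hintb : ∫ x, b w x = Complex.I * (√2 * matEl φ (opQ ψ) w + w.re * matEl φ ψ w) := by
    rw [matEl_eq_integral, matEl_eq_integral, ← integral_const_mul, ← integral_const_mul,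
      ← integral_add ((integrable_conj_mul_displaceFun φ (opQ ψ) w).const_mul _)
        ((integrable_conj_mul_displaceFun φ ψ w).const_mul _), ← integral_const_mul]
    congr 1 with x
    simp only [b]
    ring
  rw [← heq] at hmain
  refine hmain.congr_fderiv ?_
  rw [← hinta, ← hintb]
  simp only [F']
  rw [integral_add ((ContinuousLinearMap.smulRightL ℝ ℂ ℂ Complex.reCLM).integrable_comp hia)
      ((ContinuousLinearMap.smulRightL ℝ ℂ ℂ Complex.imCLM).integrable_comp hib),
    ContinuousLinearMap.integral_comp_comm _ hia, ContinuousLinearMap.integral_comp_comm _ hib]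
  rfl

/-- The induction is uniform in `ψ` because the derivative involves the matrix elements of `opP ψ`
and `opQ ψ`. -/
theorem contDiff_matEl (φ : 𝓢(ℝ, ℂ)) (n : ℕ) : ∀ ψ : 𝓢(ℝ, ℂ), ContDiff ℝ n (matEl φ ψ) := by
  induction n with
  | zero =>
    intro ψ
    rw [Nat.cast_zero, contDiff_zero]
    exact continuous_iff_continuousAt.2 fun w => (hasFDerivAt_matEl φ ψ w).continuousAt
  | succ n ih =>
    intro ψ
    have hre : ContDiff ℝ n fun w : ℂ => (w.re : ℂ) :=
      Complex.ofRealCLM.contDiff.comp Complex.reCLM.contDiff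
    have him : ContDiff ℝ n fun w : ℂ => (w.im : ℂ) :=
      Complex.ofRealCLM.contDiff.comp Complex.imCLM.contDiff
    rw [Nat.cast_succ]
    refine contDiff_succ_iff_hasFDerivAt.2 ⟨_, ?_, hasFDerivAt_matEl φ ψ⟩
    exact ((ContinuousLinearMap.smulRightL ℝ ℂ ℂ Complex.reCLM).contDiff.comp
        (contDiff_const.mul ((contDiff_const.mul (ih (opP ψ))).add (him.mul (ih ψ))))).add
      ((ContinuousLinearMap.smulRightL ℝ ℂ ℂ Complex.imCLM).contDiff.comp
        (contDiff_const.mul ((contDiff_const.mul (ih (opQ ψ))).add (hre.mul (ih ψ)))))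

end MatrixElements

/-! ### Second derivatives at the origin -/

section SecondDerivatives

theorem fderiv_fderiv_apply {f : ℂ → ℂ} (hf : ContDiffAt ℝ 2 f 0) (u v : ℂ) :
    fderiv ℝ (fun w => fderiv ℝ f w u) 0 v = fderiv ℝ (fderiv ℝ f) 0 v u := by
  have hd : DifferentiableAt ℝ (fderiv ℝ f) 0 :=
    (hf.fderiv_right (m := 1) (by norm_num)).differentiableAt (by simp)
  rw [fderiv_clm_apply hd (differentiableAt_const u)]
  simp

theorem fderiv_fderiv_mul {f g : ℂ → ℂ} (hf : ContDiffAt ℝ 2 f 0) (hg : ContDiffAt ℝ 2 g 0)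
    (u : ℂ) : fderiv ℝ (fderiv ℝ (fun w => f w * g w)) 0 u u =
      fderiv ℝ (fderiv ℝ f) 0 u u * g 0 + 2 * (fderiv ℝ f 0 u * fderiv ℝ g 0 u) +
        f 0 * fderiv ℝ (fderiv ℝ g) 0 u u := by
  have hdf : ∀ᶠ x in 𝓝 (0 : ℂ), DifferentiableAt ℝ f x :=
    (hf.eventually (by simp)).mono fun x hx => hx.differentiableAt (by simp)
  have hdg : ∀ᶠ x in 𝓝 (0 : ℂ), DifferentiableAt ℝ g x :=
    (hg.eventually (by simp)).mono fun x hx => hx.differentiableAt (by simp)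
  have hf1 : DifferentiableAt ℝ (fun w => fderiv ℝ f w u) 0 :=
    ((hf.fderiv_right (m := 1) (by norm_num)).differentiableAt (by simp)).clm_apply
      (differentiableAt_const u)
  have hg1 : DifferentiableAt ℝ (fun w => fderiv ℝ g w u) 0 :=
    ((hg.fderiv_right (m := 1) (by norm_num)).differentiableAt (by simp)).clm_apply
      (differentiableAt_const u)
  rw [← fderiv_fderiv_apply (hf.mul hg)]
  have he : (fun w => fderiv ℝ (fun w => f w * g w) w u) =ᶠ[𝓝 0]
      fun w => f w * fderiv ℝ g w u + fderiv ℝ f w u * g w := by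
    filter_upwards [hdf, hdg] with w h1 h2
    rw [fderiv_fun_mul h1 h2]
    simp [mul_comm]
  rw [he.fderiv_eq, fderiv_fun_add (hdf.self_of_nhds.fun_mul hg1) (hf1.fun_mul hdg.self_of_nhds),
    fderiv_fun_mul hdf.self_of_nhds hg1, fderiv_fun_mul hf1 hdg.self_of_nhds]
  simp only [add_apply, smul_apply, smul_eq_mul, fderiv_fderiv_apply hf, fderiv_fderiv_apply hg]
  ring

theorem fderiv_wirtinger {f : ℂ → ℂ} (hf : ContDiffAt ℝ 2 f 0) (c v : ℂ) :
    fderiv ℝ (fun w => (fderiv ℝ f w 1 + c * fderiv ℝ f w Complex.I) / 2) 0 v =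
      (fderiv ℝ (fderiv ℝ f) 0 v 1 + c * fderiv ℝ (fderiv ℝ f) 0 v Complex.I) / 2 := by
  have h (u : ℂ) : HasFDerivAt (fun w => fderiv ℝ f w u) (fderiv ℝ (fun w => fderiv ℝ f w u) 0) 0 :=
    (((hf.fderiv_right (m := 1) (by norm_num)).differentiableAt (by simp)).clm_apply
      (differentiableAt_const u)).hasFDerivAt
  have h2 := ((h 1).add ((h Complex.I).const_mul c)).mul_const (2⁻¹ : ℂ)
  refine (congrArg (fun L : ℂ →L[ℝ] ℂ => L v) h2.fderiv).trans ?_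
  simp only [add_apply, smul_apply, fderiv_fderiv_apply hf, smul_eq_mul]
  ring

theorem dz_eq (f : ℂ → ℂ) :
    dz f = fun w => (fderiv ℝ f w 1 + -Complex.I * fderiv ℝ f w Complex.I) / 2 := by
  ext w
  rw [dz]
  ring

theorem fderiv_fderiv_symm {f : ℂ → ℂ} (hf : ContDiffAt ℝ 2 f 0) (u v : ℂ) :
    fderiv ℝ (fderiv ℝ f) 0 u v = fderiv ℝ (fderiv ℝ f) 0 v u :=
  (hf.isSymmSndFDerivAt (by simp)).eq u v

/-- The mixed derivatives enter with opposite signs and cancel by symmetry. -/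
theorem dz_dzbar {f : ℂ → ℂ} (hf : ContDiffAt ℝ 2 f 0) :
    dz (dzbar f) 0 = (fderiv ℝ (fderiv ℝ f) 0 1 1 +
      fderiv ℝ (fderiv ℝ f) 0 Complex.I Complex.I) / 4 := by
  have h := fderiv_wirtinger hf Complex.I
  rw [dz]
  unfold dzbar
  rw [h, h, fderiv_fderiv_symm hf 1 Complex.I]
  linear_combination (-fderiv ℝ (fderiv ℝ f) 0 Complex.I Complex.I / 4) * Complex.I_mul_I

/-- Each summand contains a mixed derivative; these are opposite and vanish in the sum. -/
theorem dz_dz_add_dzbar_dzbar {f : ℂ → ℂ} (hf : ContDiffAt ℝ 2 f 0) :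
    dz (dz f) 0 + dzbar (dzbar f) 0 = (fderiv ℝ (fderiv ℝ f) 0 1 1 -
      fderiv ℝ (fderiv ℝ f) 0 Complex.I Complex.I) / 2 := by
  have h := fderiv_wirtinger hf Complex.I
  have h' := fderiv_wirtinger hf (-Complex.I)
  rw [dz_eq f, dz]
  rw [dzbar]
  unfold dzbar
  rw [h, h, h', h', fderiv_fderiv_symm hf 1 Complex.I]
  linear_combination (fderiv ℝ (fderiv ℝ f) 0 Complex.I Complex.I / 2) * Complex.I_mul_I

theorem fderiv_matEl_one (φ ψ : 𝓢(ℝ, ℂ)) (w : ℂ) :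
    fderiv ℝ (matEl φ ψ) w 1 = -Complex.I * (√2 * matEl φ (opP ψ) w + w.im * matEl φ ψ w) := by
  rw [(hasFDerivAt_matEl φ ψ w).fderiv]
  simp

theorem fderiv_matEl_I (φ ψ : 𝓢(ℝ, ℂ)) (w : ℂ) :
    fderiv ℝ (matEl φ ψ) w Complex.I =
      Complex.I * (√2 * matEl φ (opQ ψ) w + w.re * matEl φ ψ w) := by
  rw [(hasFDerivAt_matEl φ ψ w).fderiv]
  simp

theorem hasFDerivAt_ofReal_re (w : ℂ) :
    HasFDerivAt (fun w : ℂ => (w.re : ℂ)) (Complex.ofRealCLM ∘L Complex.reCLM) w :=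
  (Complex.ofRealCLM ∘L Complex.reCLM).hasFDerivAt

theorem hasFDerivAt_ofReal_im (w : ℂ) :
    HasFDerivAt (fun w : ℂ => (w.im : ℂ)) (Complex.ofRealCLM ∘L Complex.imCLM) w :=
  (Complex.ofRealCLM ∘L Complex.imCLM).hasFDerivAt

theorem ofReal_sqrt_two_mul_self : ((√2 : ℝ) : ℂ) * (√2 : ℝ) = 2 := by
  exact_mod_cast Real.mul_self_sqrt (by norm_num)

/-- The coefficient `w.im` vanishes at `0` together with its derivative along `1`, so only `(-i√2)²
= -2` times the `P²` term survives. -/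
theorem fderiv_fderiv_matEl_one (φ ψ : 𝓢(ℝ, ℂ)) :
    fderiv ℝ (fderiv ℝ (matEl φ ψ)) 0 1 1 = -2 * matEl φ (opP (opP ψ)) 0 := by
  rw [← fderiv_fderiv_apply (contDiff_matEl φ 2 ψ).contDiffAt]
  have h := (((hasFDerivAt_matEl φ (opP ψ) 0).const_mul (√2 : ℂ)).add
    ((hasFDerivAt_ofReal_im 0).mul (hasFDerivAt_matEl φ ψ 0))).const_mul (-Complex.I)
  rw [show (fun w => fderiv ℝ (matEl φ ψ) w 1) = _ from funext (fderiv_matEl_one φ ψ)]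
  refine (congrArg (fun L : ℂ →L[ℝ] ℂ => L 1) h.fderiv).trans ?_
  simp
  linear_combination (Complex.I * Complex.I * matEl φ (opP (opP ψ)) 0) * ofReal_sqrt_two_mul_self +
    2 * matEl φ (opP (opP ψ)) 0 * Complex.I_mul_I

theorem fderiv_fderiv_matEl_I (φ ψ : 𝓢(ℝ, ℂ)) :
    fderiv ℝ (fderiv ℝ (matEl φ ψ)) 0 Complex.I Complex.I = -2 * matEl φ (opQ (opQ ψ)) 0 := by
  rw [← fderiv_fderiv_apply (contDiff_matEl φ 2 ψ).contDiffAt]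
  have h := (((hasFDerivAt_matEl φ (opQ ψ) 0).const_mul (√2 : ℂ)).add
    ((hasFDerivAt_ofReal_re 0).mul (hasFDerivAt_matEl φ ψ 0))).const_mul Complex.I
  rw [show (fun w => fderiv ℝ (matEl φ ψ) w Complex.I) = _ from funext (fderiv_matEl_I φ ψ)]
  refine (congrArg (fun L : ℂ →L[ℝ] ℂ => L Complex.I) h.fderiv).trans ?_
  simp
  linear_combination (Complex.I * Complex.I * matEl φ (opQ (opQ ψ)) 0) * ofReal_sqrt_two_mul_self +
    2 * matEl φ (opQ (opQ ψ)) 0 * Complex.I_mul_I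

end SecondDerivatives

/-! ### Quantization of quadratic functions -/

section Quantization

/-- The functional `ψ ↦ ⟨φ, ψ⟩` on the Schwartz space. -/
def pair (φ : 𝓢(ℝ, ℂ)) : 𝓢(ℝ, ℂ) →ₗ[ℂ] ℂ :=
  ((innerSL ℂ (vec φ)) ∘L (toLpCLM ℂ ℂ 2 (volume : Measure ℝ))).toLinearMap

theorem pair_apply (φ ψ : 𝓢(ℝ, ℂ)) : pair φ ψ = inner ℂ (vec φ) (vec ψ) := rfl

variable {M : Hilb →L[ℂ] Hilb}

theorem IsQuantization.add {f g : ℂ → ℂ} {A B : Module.End ℂ 𝓢(ℝ, ℂ)} (hA : IsQuantization M f A)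
    (hB : IsQuantization M g B) : IsQuantization M (fun z => f z + g z) (A + B) := by
  intro φ ψ
  have h := (hA φ ψ).add (hB φ ψ)
  rw [← pair_apply, ← pair_apply, ← map_add, ← LinearMap.add_apply] at h
  refine (congrArg (HasOscIntegral · _) (funext fun z => ?_)).mp h
  ring

theorem IsQuantization.smul {f : ℂ → ℂ} {A : Module.End ℂ 𝓢(ℝ, ℂ)} (hA : IsQuantization M f A)
    (c : ℂ) : IsQuantization M (fun z => c * f z) (c • A) := by
  intro φ ψ
  have h := (hA φ ψ).const_mul c
  rw [← pair_apply, ← smul_eq_mul, ← map_smul, ← LinearMap.smul_apply] at h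
  refine (congrArg (HasOscIntegral · _) (funext fun z => ?_)).mp h
  ring

/-- Multiplication by `i`, as an isometry of the plane. -/
def mulI : ℂ ≃ₗᵢ[ℝ] ℂ := rotation ⟨Complex.I, mem_sphere_zero_iff_norm.2 Complex.norm_I⟩

theorem mulI_apply (z : ℂ) : mulI z = Complex.I * z := rfl

theorem hasOscIntegral_inner_sq_mul_displaced {ϖ : ℂ → ℂ} (hM : IsWeightOperator ϖ M)
    (hϖ : ContDiffAt ℝ 2 ϖ 0) (φ ψ : 𝓢(ℝ, ℂ)) (u : ℂ) :
    HasOscIntegral (fun z : ℂ => ((inner ℝ (Complex.I * z) u : ℝ) : ℂ) ^ 2 *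
        inner ℂ (vec φ) (displaced M z (vec ψ)) / Real.pi)
      (-(1 / 4) * fderiv ℝ (fderiv ℝ fun w => ϖ w * matEl φ ψ w) 0 u u) := by
  have hV : ContDiffAt ℝ 2 (matEl φ ψ) 0 := (contDiff_matEl φ 2 ψ).contDiffAt
  have hc : ContDiffAt ℝ 2 (fun w => ϖ w * matEl φ ψ w) 0 := hϖ.mul hV
  have h2 : fderiv ℝ (fderiv ℝ fun w => ϖ w * matEl φ ψ w / Real.pi) 0 u u =
      (Real.pi : ℂ)⁻¹ * fderiv ℝ (fderiv ℝ fun w => ϖ w * matEl φ ψ w) 0 u u := by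
    have := fderiv_fderiv_mul hc (contDiffAt_const (c := (Real.pi : ℂ)⁻¹)) u
    simp only [div_eq_mul_inv]
    rw [this]
    simp [mul_comm]
  have hi : Integrable fun w => ϖ w * matEl φ ψ w / Real.pi := (hM φ ψ).1
  -- The dilation by `π⁻¹` contributes a Jacobian `π²`, which cancels that of `-1/(4π²)`; the final
  -- factor `π` cancels the `1/π` in `h2`, leaving `-1/4`.
  have h := (((hasOscIntegral_inner_sq_mul_fourier hi
    (hc.div_const (Real.pi : ℂ)) u).comp_smul (inv_pos.2 Real.pi_pos)).comp_linearIsometryEquiv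
      mulI).const_mul (Real.pi : ℂ)
  rw [h2] at h
  convert h using 1
  · ext z
    rw [inner_displaced hM, mulI_apply, real_inner_smul_left]
    push_cast
    field_simp
  · rw [Complex.real_smul]
    push_cast
    field_simp

/-- The quantization of `(Re z)²`. -/
theorem isQuantization_re_sq {ϖ : ℂ → ℂ} (hM : IsWeightOperator ϖ M)
    (hϖ : ContDiffAt ℝ 2 ϖ 0) :
    IsQuantization M (fun z => (z.re : ℂ) ^ 2)
      ((ϖ 0 / 2) • opQ ^ 2 - (Complex.I * fderiv ℝ ϖ 0 Complex.I * (√2 / 2)) • opQ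
        - (fderiv ℝ (fderiv ℝ ϖ) 0 Complex.I Complex.I / 4) • 1) := by
  intro φ ψ
  -- The direction `u = i` gives `⟨i z, i⟩ = Re z`.
  have h := hasOscIntegral_inner_sq_mul_displaced hM hϖ φ ψ Complex.I
  rw [fderiv_fderiv_mul hϖ (contDiff_matEl φ 2 ψ).contDiffAt, fderiv_matEl_I,
    fderiv_fderiv_matEl_I, matEl_zero, matEl_zero, matEl_zero] at h
  convert h using 2 with z
  · simp [Complex.inner]
  · simp only [← pair_apply, LinearMap.sub_apply, LinearMap.smul_apply, map_sub, map_smul,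
      pow_two, Module.End.mul_apply, Module.End.one_apply, smul_eq_mul]
    simp
    ring

/-- The quantization of `(Im z)²`. -/
theorem isQuantization_im_sq {ϖ : ℂ → ℂ} (hM : IsWeightOperator ϖ M)
    (hϖ : ContDiffAt ℝ 2 ϖ 0) :
    IsQuantization M (fun z => (z.im : ℂ) ^ 2)
      ((ϖ 0 / 2) • opP ^ 2 + (Complex.I * fderiv ℝ ϖ 0 1 * (√2 / 2)) • opP
        - (fderiv ℝ (fderiv ℝ ϖ) 0 1 1 / 4) • 1) := by
  intro φ ψ
  -- The direction `u = 1` gives `⟨i z, 1⟩ = -Im z`, whose sign disappears in the square.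
  have h := hasOscIntegral_inner_sq_mul_displaced hM hϖ φ ψ 1
  rw [fderiv_fderiv_mul hϖ (contDiff_matEl φ 2 ψ).contDiffAt, fderiv_matEl_one,
    fderiv_fderiv_matEl_one, matEl_zero, matEl_zero, matEl_zero] at h
  convert h using 2 with z
  · simp [Complex.inner]
  · simp only [← pair_apply, LinearMap.sub_apply, LinearMap.add_apply, LinearMap.smul_apply,
      map_sub, map_add, map_smul,
      pow_two, Module.End.mul_apply, Module.End.one_apply, smul_eq_mul]
    simp
    ring

/-- The canonical commutation relation. -/
theorem opP_mul_opQ : opP * opQ = opQ * opP - Complex.I • (1 : Module.End ℂ 𝓢(ℝ, ℂ)) := by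
  ext ψ x
  have h : HasDerivAt (fun y : ℝ => opQ ψ y) (1 * ψ x + x * deriv ψ x) x := by
    have h1 : HasDerivAt (fun y : ℝ => (y : ℂ)) 1 x := (hasDerivAt_id x).ofReal_comp
    exact (h1.mul (ψ.hasDerivAt x)).congr_of_eventuallyEq
      (Eventually.of_forall fun y => opQ_apply ψ y)
  change opP (opQ ψ) x = opQ (opP ψ) x - Complex.I * ψ x
  rw [opP_apply, opQ_apply, opP_apply, h.deriv]
  ring

theorem inv_sqrt_two_mul_self : ((√2 : ℝ) : ℂ)⁻¹ * ((√2 : ℝ) : ℂ)⁻¹ = 1 / 2 := by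
  rw [← mul_inv, ofReal_sqrt_two_mul_self, one_div]

theorem opAdag_mul_opA :
    opAdag * opA = (1 / 2 : ℂ) • (opQ ^ 2 + opP ^ 2 - (1 : Module.End ℂ 𝓢(ℝ, ℂ))) := by
  rw [opAdag, opA, smul_mul_smul_comm, inv_sqrt_two_mul_self]
  congr 1
  simp only [sub_mul, mul_add, smul_mul_assoc, mul_smul_comm, opP_mul_opQ, smul_sub, smul_smul,
    Complex.I_mul_I, pow_two]
  module

end Quantization

/-! ### Uniqueness of the quantization, and minima of the operators -/

section Energies

/-- A quantization is determined by the function and the operator `M`. -/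
theorem IsQuantization.unique {M : Hilb →L[ℂ] Hilb} {f : ℂ → ℂ} {A B : Module.End ℂ 𝓢(ℝ, ℂ)}
    (hA : IsQuantization M f A) (hB : IsQuantization M f B) : A = B := by
  refine LinearMap.ext fun ψ => injective_toLp 2 (volume : Measure ℝ) ?_
  have h (φ : 𝓢(ℝ, ℂ)) : pair φ (A ψ - B ψ) = 0 := by
    rw [map_sub, sub_eq_zero]
    exact (hA φ ψ).unique (hB φ ψ)
  have h0 : vec (A ψ - B ψ) = 0 := inner_self_eq_zero.1 (h (A ψ - B ψ))
  rwa [show vec (A ψ - B ψ) = vec (A ψ) - vec (B ψ) from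
    map_sub (toLpCLM ℂ ℂ 2 (volume : Measure ℝ)) _ _, sub_eq_zero] at h0

theorem inner_vec (φ ψ : 𝓢(ℝ, ℂ)) : inner ℂ (vec φ) (vec ψ) = ∫ x, ψ x * conj (φ x) :=
  inner_toL2_toL2_eq φ ψ volume

theorem inner_opQ (φ ψ : 𝓢(ℝ, ℂ)) :
    inner ℂ (vec (opQ φ)) (vec ψ) = inner ℂ (vec φ) (vec (opQ ψ)) := by
  rw [inner_vec, inner_vec]
  congr 1 with x
  rw [opQ_apply, opQ_apply, map_mul, Complex.conj_ofReal]
  ring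

/-- Integration by parts: its minus sign is compensated by the conjugation of `-i`. -/
theorem inner_opP (φ ψ : 𝓢(ℝ, ℂ)) :
    inner ℂ (vec (opP φ)) (vec ψ) = inner ℂ (vec φ) (vec (opP ψ)) := by
  rw [inner_vec, inner_vec]
  let φc : 𝓢(ℝ, ℂ) := φ.postcompCLM (Complex.conjCLE : ℂ →L[ℝ] ℂ)
  have hc (x : ℝ) : φc x = conj (φ x) := rfl
  have hd (x : ℝ) : deriv φc x = conj (deriv φ x) :=
    ((Complex.conjCLE : ℂ →L[ℝ] ℂ).hasFDerivAt.comp_hasDerivAt x (φ.hasDerivAt x)).deriv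
  have h := integral_mul_deriv_eq_neg_deriv_mul φc ψ
  simp only [hc, hd] at h
  have h1 : ∫ x, ψ x * conj (opP φ x) = Complex.I * ∫ x, conj (deriv φ x) * ψ x := by
    rw [← integral_const_mul]
    congr 1 with x
    rw [opP_apply]
    simp
    ring
  have h2 : ∫ x, opP ψ x * conj (φ x) = -Complex.I * ∫ x, conj (φ x) * deriv ψ x := by
    rw [← integral_const_mul]
    congr 1 with x
    rw [opP_apply]
    ring
  rw [h1, h2, h]
  ring

theorem vec_smul (c : ℂ) (φ : 𝓢(ℝ, ℂ)) : vec (c • φ) = c • vec φ :=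
  map_smul (toLpCLM ℂ ℂ 2 (volume : Measure ℝ)) c φ

theorem vec_add (φ ψ : 𝓢(ℝ, ℂ)) : vec (φ + ψ) = vec φ + vec ψ :=
  map_add (toLpCLM ℂ ℂ 2 (volume : Measure ℝ)) φ ψ

theorem vec_sub (φ ψ : 𝓢(ℝ, ℂ)) : vec (φ - ψ) = vec φ - vec ψ :=
  map_sub (toLpCLM ℂ ℂ 2 (volume : Measure ℝ)) φ ψ

theorem inner_opA (φ ψ : 𝓢(ℝ, ℂ)) :
    inner ℂ (vec (opA φ)) (vec ψ) = inner ℂ (vec φ) (vec (opAdag ψ)) := by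
  simp only [opA, opAdag, LinearMap.smul_apply, LinearMap.add_apply, LinearMap.sub_apply, vec_smul,
    vec_add, vec_sub, inner_smul_left, inner_smul_right, inner_add_left, inner_sub_right,
    inner_opQ, inner_opP]
  simp
  ring

/-- The bottom of `B† B + m`, when `B` has arbitrarily small relative norm. -/
theorem isMinOf_mul_add_smul {B B' : Module.End ℂ 𝓢(ℝ, ℂ)}
    (hB : ∀ φ ψ, inner ℂ (vec (B φ)) (vec ψ) = inner ℂ (vec φ) (vec (B' ψ)))
    (hs : ∀ η > 0, ∃ φ, vec φ ≠ 0 ∧ ‖vec (B φ)‖ ≤ η * ‖vec φ‖) (m : ℝ) :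
    IsMinOf (B' * B + (m : ℂ) • 1) m := by
  have he (φ : 𝓢(ℝ, ℂ)) : expect (B' * B + (m : ℂ) • 1) φ =
      ((‖vec (B φ)‖ ^ 2 + m * ‖vec φ‖ ^ 2 : ℝ) : ℂ) := by
    rw [expect, LinearMap.add_apply, LinearMap.smul_apply, Module.End.mul_apply,
      Module.End.one_apply, vec_add, vec_smul, inner_add_right, inner_smul_right, ← hB,
      inner_self_eq_norm_sq_to_K, inner_self_eq_norm_sq_to_K]
    push_cast
    rfl
  refine ⟨fun φ => by rw [he, Complex.ofReal_im], ?_, ?_⟩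
  · rintro r ⟨φ, hφ, rfl⟩
    rw [he, Complex.ofReal_re, hφ]
    nlinarith [sq_nonneg ‖vec (B φ)‖]
  · intro b hb
    refine le_of_forall_pos_le_add fun η hη => ?_
    -- The expectation value is quadratic in `B φ`, so a relative norm `√η` costs an energy of at
    -- most `η`.
    obtain ⟨φ, h0, hφ⟩ := hs (√η) (Real.sqrt_pos.2 hη)
    have hn : 0 < ‖vec φ‖ := norm_pos_iff.2 h0
    refine hb ⟨((‖vec φ‖⁻¹ : ℝ) : ℂ) • φ, ?_, rfl⟩ |>.trans ?_
    · rw [vec_smul, norm_smul, Complex.norm_real, norm_inv, norm_norm, inv_mul_cancel₀ hn.ne']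
    · rw [he, Complex.ofReal_re, map_smul, vec_smul, vec_smul, norm_smul, norm_smul,
        Complex.norm_real, norm_inv, norm_norm, inv_mul_cancel₀ hn.ne']
      have h1 : ‖vec φ‖⁻¹ * ‖vec (B φ)‖ ≤ √η := by
        rw [inv_mul_le_iff₀ hn, mul_comm]
        exact hφ
      have h2 : (‖vec φ‖⁻¹ * ‖vec (B φ)‖) ^ 2 ≤ √η ^ 2 := by gcongr
      rw [Real.sq_sqrt hη.le] at h2
      linarith

/-- The dilated function `x ↦ φ(s x)`. -/
def dilate (s : ℝ) (hs : s ≠ 0) (φ : 𝓢(ℝ, ℂ)) : 𝓢(ℝ, ℂ) :=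
  compCLMOfContinuousLinearEquiv ℂ (ContinuousLinearEquiv.unitsEquivAut ℝ (Units.mk0 s hs)) φ

theorem dilate_apply (s : ℝ) (hs : s ≠ 0) (φ : 𝓢(ℝ, ℂ)) (x : ℝ) : dilate s hs φ x = φ (x * s) :=
  rfl

theorem norm_vec_dilate (s : ℝ) (hs : s ≠ 0) (φ : 𝓢(ℝ, ℂ)) :
    ‖vec (dilate s hs φ)‖ = √|s⁻¹| * ‖vec φ‖ := by
  have h (φ : 𝓢(ℝ, ℂ)) : ((‖vec φ‖ ^ 2 : ℝ) : ℂ) = ∫ x, φ x * conj (φ x) := by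
    rw [← inner_vec, inner_self_eq_norm_sq_to_K]
    push_cast
    rfl
  have h2 : ‖vec (dilate s hs φ)‖ ^ 2 = |s⁻¹| * ‖vec φ‖ ^ 2 := by
    apply Complex.ofReal_injective
    rw [h, Complex.ofReal_mul, h]
    exact Measure.integral_comp_mul_right (fun x => φ x * conj (φ x)) s
  rw [← Real.sqrt_sq (norm_nonneg (vec (dilate s hs φ))), h2, Real.sqrt_mul (abs_nonneg _),
    Real.sqrt_sq (norm_nonneg _)]

theorem opQ_dilate (s : ℝ) (hs : s ≠ 0) (φ : 𝓢(ℝ, ℂ)) :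
    opQ (dilate s hs φ) = ((s⁻¹ : ℝ) : ℂ) • dilate s hs (opQ φ) := by
  ext x
  have : (s : ℂ) ≠ 0 := by exact_mod_cast hs
  rw [smul_apply, opQ_apply, dilate_apply, dilate_apply, opQ_apply]
  push_cast
  simp only [smul_eq_mul]
  field_simp

theorem opP_dilate (s : ℝ) (hs : s ≠ 0) (φ : 𝓢(ℝ, ℂ)) :
    opP (dilate s hs φ) = (s : ℂ) • dilate s hs (opP φ) := by
  ext x
  have h : HasDerivAt (dilate s hs φ) (s • deriv φ (x * s)) x :=
    HasDerivAt.scomp (g₁ := φ) (h := fun y => y * s) x (φ.hasDerivAt (x * s))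
      (by simpa using (hasDerivAt_id x).mul_const s)
  rw [smul_apply, opP_apply, dilate_apply, opP_apply, h.deriv, Complex.real_smul, smul_eq_mul]
  ring

/-- Dilations make an operator of negative degree of homogeneity relatively small. -/
theorem exists_norm_le_of_dilate {B : Module.End ℂ 𝓢(ℝ, ℂ)} {c : ℝ → ℝ}
    (hc : ∀ η > 0, ∃ s, s ≠ 0 ∧ |c s| ≤ η)
    (hB : ∀ s (hs : s ≠ 0) φ, B (dilate s hs φ) = (c s : ℂ) • dilate s hs (B φ))
    {φ : 𝓢(ℝ, ℂ)} (hφ : vec φ ≠ 0) :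
    ∀ η > 0, ∃ φ, vec φ ≠ 0 ∧ ‖vec (B φ)‖ ≤ η * ‖vec φ‖ := by
  intro η hη
  have hn : 0 < ‖vec φ‖ := norm_pos_iff.2 hφ
  obtain ⟨s, hs, hcs⟩ := hc (η * ‖vec φ‖ / (‖vec (B φ)‖ + 1)) (by positivity)
  have h0 : 0 < √|s⁻¹| := Real.sqrt_pos.2 (abs_pos.2 (inv_ne_zero hs))
  refine ⟨dilate s hs φ, norm_pos_iff.1 ?_, ?_⟩
  · rw [norm_vec_dilate]
    positivity
  · rw [hB, vec_smul, norm_smul, norm_vec_dilate, norm_vec_dilate, Complex.norm_real,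
      Real.norm_eq_abs]
    rw [le_div_iff₀ (by positivity)] at hcs
    have : |c s| * ‖vec (B φ)‖ ≤ η * ‖vec φ‖ := by
      nlinarith [abs_nonneg (c s)]
    nlinarith

open Polynomial in
-- For monomials, `|x|ⁿ ≤ 1 + x²ⁿ` and `(x²/2)ⁿ / n! ≤ exp (x²/2)` give the constant `1 + 2ⁿ n!`.
theorem exists_polynomial_mul_gaussian_le (p : ℝ[X]) :
    ∃ C, ∀ x : ℝ, |p.eval x| * Real.exp (-(x ^ 2 / 2)) ≤ C := by
  induction p using Polynomial.induction_on' with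
  | add p q hp hq =>
    obtain ⟨C, hC⟩ := hp
    obtain ⟨C', hC'⟩ := hq
    refine ⟨C + C', fun x => ?_⟩
    rw [eval_add]
    refine le_trans ?_ (add_le_add (hC x) (hC' x))
    rw [← add_mul]
    gcongr
    exact abs_add_le _ _
  | monomial n a =>
    refine ⟨|a| * (1 + 2 ^ n * n.factorial), fun x => ?_⟩
    rw [eval_monomial, abs_mul, abs_pow, mul_assoc]
    gcongr
    have h1 := Real.pow_div_factorial_le_exp (x ^ 2 / 2) (by positivity) n
    have h2 : 1 ≤ Real.exp (x ^ 2 / 2) := Real.one_le_exp (by positivity)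
    rw [Real.exp_neg, ← div_eq_mul_inv, div_le_iff₀ (Real.exp_pos _)]
    rw [div_le_iff₀ (by positivity), div_pow, div_le_iff₀ (by positivity)] at h1
    have h3 : |x| ^ n ≤ 1 + (x ^ 2) ^ n := by
      rw [← sq_abs, ← pow_mul, mul_comm 2 n, pow_mul]
      nlinarith [sq_nonneg (|x| ^ n - 1)]
    nlinarith

/-- The Gaussian `e^{-x²/2}` as a real Schwartz function. -/
def realGauss : 𝓢(ℝ, ℝ) where
  toFun x := Real.exp (-(x ^ 2 / 2))
  smooth' := by fun_prop
  decay' k n := by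
    -- The `n`-th derivative of the Gaussian is, up to sign, the `n`-th Hermite polynomial times the
    -- Gaussian.
    obtain ⟨C, hC⟩ := exists_polynomial_mul_gaussian_le
      (Polynomial.X ^ k * (Polynomial.hermite n).map (algebraMap ℤ ℝ))
    refine ⟨C, fun x => le_trans (le_of_eq ?_) (hC x)⟩
    rw [norm_iteratedFDeriv_eq_norm_iteratedDeriv, iteratedDeriv_eq_iterate,
      Polynomial.deriv_gaussian_eq_hermite_mul_gaussian, Polynomial.aeval_def,
      ← Polynomial.eval_map]
    simp [abs_mul, mul_assoc]

/-- The ground state of the harmonic oscillator. -/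
def gauss : 𝓢(ℝ, ℂ) := realGauss.postcompCLM Complex.ofRealCLM

theorem gauss_apply (x : ℝ) : gauss x = (Real.exp (-(x ^ 2 / 2)) : ℂ) := rfl

theorem gauss_ne_zero : gauss ≠ 0 := fun h => by
  have := congrArg (fun φ : 𝓢(ℝ, ℂ) => φ 0) h
  simp [gauss_apply] at this

theorem vec_gauss_ne_zero : vec gauss ≠ 0 := fun h => by
  refine gauss_ne_zero (injective_toLp 2 (volume : Measure ℝ) (h.trans ?_))
  exact (map_zero (toLpCLM ℂ ℂ 2 (volume : Measure ℝ))).symm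

theorem opA_gauss : opA gauss = 0 := by
  ext x
  have h : HasDerivAt (fun x : ℝ => Real.exp (-(x ^ 2 / 2))) (Real.exp (-(x ^ 2 / 2)) * -x) x := by
    have := ((hasDerivAt_pow 2 x).div_const 2).fun_neg.exp
    convert this using 2
    norm_num
  have h' : HasDerivAt gauss ((Real.exp (-(x ^ 2 / 2)) * -x : ℝ) : ℂ) x := h.ofReal_comp
  change ((√2 : ℝ) : ℂ)⁻¹ * (opQ gauss x + Complex.I * opP gauss x) = 0
  rw [opQ_apply, opP_apply, h'.deriv, gauss_apply]
  push_cast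
  linear_combination ((√2 : ℝ) : ℂ)⁻¹ * Complex.exp (-(x ^ 2 / 2)) * x * Complex.I_mul_I

theorem isGroundStateEnergy_oscillator (m : ℝ) :
    IsGroundStateEnergy (opAdag * opA + (m : ℂ) • 1) m := by
  refine ⟨isMinOf_mul_add_smul inner_opA (fun η hη => ⟨gauss, vec_gauss_ne_zero, ?_⟩) m, ?_⟩
  · rw [opA_gauss, show vec 0 = 0 from map_zero (toLpCLM ℂ ℂ 2 (volume : Measure ℝ)), norm_zero]
    positivity
  · refine Module.End.hasEigenvalue_of_hasEigenvector (x := gauss)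
      (Module.End.hasEigenvector_iff.2 ⟨Module.End.mem_eigenspace_iff.2 ?_, gauss_ne_zero⟩)
    rw [LinearMap.add_apply, Module.End.mul_apply, opA_gauss, map_zero, zero_add,
      LinearMap.smul_apply, Module.End.one_apply]

/-- Compressing the Gaussian towards the origin makes `Q` relatively small; for `P` it is spread out
instead. -/
theorem isMinOf_opQ_sq (m : ℝ) : IsMinOf (opQ ^ 2 + (m : ℂ) • 1) m := by
  rw [pow_two]
  refine isMinOf_mul_add_smul inner_opQ (exists_norm_le_of_dilate (c := fun s => s⁻¹)
    (fun η hη => ⟨η⁻¹, (inv_pos.2 hη).ne', ?_⟩) opQ_dilate vec_gauss_ne_zero) m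
  simp [abs_of_pos hη]

theorem isMinOf_opP_sq (m : ℝ) : IsMinOf (opP ^ 2 + (m : ℂ) • 1) m := by
  rw [pow_two]
  refine isMinOf_mul_add_smul inner_opP (exists_norm_le_of_dilate (c := fun s => s)
    (fun η hη => ⟨η, hη.ne', ?_⟩) opP_dilate vec_gauss_ne_zero) m
  simp [abs_of_pos hη]

end Energies

/-! ### Consequences of evenness and reality of the weight -/

section RegularWeights

theorem fderiv_apply_im_eq_zero {f : ℂ → ℂ} (hf : ∀ w, (f w).im = 0) (w u : ℂ) :
    (fderiv ℝ f w u).im = 0 := by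
  by_cases hd : DifferentiableAt ℝ f w
  · have h := (Complex.imCLM.hasFDerivAt.comp w hd.hasFDerivAt).fderiv
    have h0 : Complex.imCLM ∘ f = fun _ => (0 : ℝ) := funext hf
    rw [h0] at h
    have := congrArg (fun L : ℂ →L[ℝ] ℝ => L u) h
    simpa using this.symm
  · simp [fderiv_zero_of_not_differentiableAt hd]

theorem fderiv_fderiv_apply_im_eq_zero {f : ℂ → ℂ} (hf : ContDiffAt ℝ 2 f 0)
    (hr : ∀ w, (f w).im = 0) (u v : ℂ) : (fderiv ℝ (fderiv ℝ f) 0 v u).im = 0 := by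
  rw [← fderiv_fderiv_apply hf]
  exact fderiv_apply_im_eq_zero (fun w => fderiv_apply_im_eq_zero hr w u) 0 v

/-- The derivative at `0` equals its own negative. This removes the terms linear in `a`, `a†`, `Q`
and `P` for regular weights. -/
theorem fderiv_zero_of_even {f : ℂ → ℂ} (hf : ∀ z, f (-z) = f z) : fderiv ℝ f 0 = 0 := by
  by_cases hd : DifferentiableAt ℝ f 0
  · have h := HasFDerivAt.comp (g := f) (f := fun z : ℂ => -z) (0 : ℂ)
      (by simpa using hd.hasFDerivAt) (hasFDerivAt_id (𝕜 := ℝ) (0 : ℂ)).neg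
    have he : f ∘ (fun z : ℂ => -z) = f := funext hf
    rw [he] at h
    have h' := hd.hasFDerivAt.unique h
    refine ContinuousLinearMap.ext fun u => ?_
    have hu : fderiv ℝ f 0 u = -fderiv ℝ f 0 u := by
      simpa using congrArg (fun L : ℂ →L[ℝ] ℂ => L u) h'
    rw [zero_apply]
    linear_combination hu / 2
  · exact fderiv_zero_of_not_differentiableAt hd

end RegularWeights

/-! ### Assembly of the theorem -/

theorem isQuantization_norm_sq {ϖ : ℂ → ℂ} {M : Hilb →L[ℂ] Hilb} (hM : IsWeightOperator ϖ M)
    (hϖ : ContDiffAt ℝ 2 ϖ 0) :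
    IsQuantization M (fun z => (‖z‖ ^ 2 : ℝ))
      (ϖ 0 • (opAdag * opA) + dz ϖ 0 • opA - dzbar ϖ 0 • opAdag
        + (ϖ 0 / 2 - dz (dzbar ϖ) 0) • 1) := by
  have h := (isQuantization_re_sq hM hϖ).add (isQuantization_im_sq hM hϖ)
  convert h using 1
  · ext z
    rw [Complex.sq_norm, Complex.normSq_apply]
    push_cast
    ring
  · rw [opAdag_mul_opA, dz_dzbar hϖ, opA, opAdag, dz, dzbar,
      show ((√2 : ℝ) : ℂ)⁻¹ = (√2 : ℝ) / 2 from by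
        rw [inv_eq_iff_eq_inv, inv_div, eq_div_iff (by simp), ofReal_sqrt_two_mul_self]]
    module

end IntegralQuantization

end

theorem mainTheorem4 (ϖ : ℂ → ℂ)
    (M : Hilb →L[ℂ] Hilb)
    (hM : IsWeightOperator ϖ M)
    (hϖ : ContDiffAt ℝ 2 ϖ 0) :
    -- the general weight
    IsQuantization M (fun z => (‖z‖ ^ 2 : ℝ))
      (ϖ 0 • (opAdag * opA)
        + dz ϖ 0 • opA
        - dzbar ϖ 0 • opAdag
        + (ϖ 0 / 2 - dz (dzbar ϖ) 0) • 1) ∧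
    -- regular weights
    (IsRegularWeight ϖ →
      IsQuantization M (fun z => (‖z‖ ^ 2 : ℝ))
        (opAdag * opA
          + (1 / 2 - dz (dzbar ϖ) 0) • 1) ∧
      IsQuantization M (fun z => (qOf z ^ 2 : ℝ))
        (opQ ^ 2
          + (-dz (dzbar ϖ) 0
              + 1 / 2 * (dz (dz ϖ) 0
                + dzbar (dzbar ϖ) 0)) • 1) ∧
      IsQuantization M (fun z => (pOf z ^ 2 : ℝ))
        (opP ^ 2
          + (-dz (dzbar ϖ) 0
              - 1 / 2 * (dz (dz ϖ) 0
                + dzbar (dzbar ϖ) 0)) • 1) ∧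
      -- the ground state energy and the minimum of the quantum potential energy; these operators
      -- are the only ones on the Schwartz space that represent the three quantizations
      ∀ H Aq Ap : Module.End ℂ (SchwartzMap ℝ ℂ),
        IsQuantization M (fun z => (‖z‖ ^ 2 : ℝ)) H →
        IsQuantization M
          (fun z => (qOf z ^ 2 : ℝ)) Aq →
        IsQuantization M
          (fun z => (pOf z ^ 2 : ℝ)) Ap →
        ∃ E₀ mq mp Em : ℝ,
          IsGroundStateEnergy H E₀ ∧
          IsMinOf Aq mq ∧
          IsMinOf Ap mp ∧
          Em = (mq + mp) / 2 ∧
          (E₀ : ℂ) = 1 / 2 - dz (dzbar ϖ) 0 ∧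
          (Em : ℂ) = -dz (dzbar ϖ) 0 ∧
          E₀ - Em = 1 / 2) := by
  refine ⟨isQuantization_norm_sq hM hϖ, fun hr => ?_⟩
  have hd0 : fderiv ℝ ϖ 0 = 0 := fderiv_zero_of_even hr.even
  have him (w : ℂ) : (ϖ w).im = 0 := Complex.conj_eq_iff_im.1 (hr.real w)
  have hH : IsQuantization M (fun z => (‖z‖ ^ 2 : ℝ))
      (opAdag * opA + (1 / 2 - dz (dzbar ϖ) 0) • 1) := by
    have h := isQuantization_norm_sq hM hϖ
    simpa [hr.map_zero, dz, dzbar, hd0] using h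
  obtain ⟨a, ha⟩ : ∃ a : ℂ, a = fderiv ℝ (fderiv ℝ ϖ) 0 1 1 := ⟨_, rfl⟩
  obtain ⟨b, hb⟩ : ∃ b : ℂ, b = fderiv ℝ (fderiv ℝ ϖ) 0 Complex.I Complex.I := ⟨_, rfl⟩
  have hare : ((a.re : ℝ) : ℂ) = a :=
    Complex.conj_eq_iff_re.1 (Complex.conj_eq_iff_im.2
      (ha ▸ fderiv_fderiv_apply_im_eq_zero hϖ him 1 1))
  have hbre : ((b.re : ℝ) : ℂ) = b :=
    Complex.conj_eq_iff_re.1 (Complex.conj_eq_iff_im.2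
      (hb ▸ fderiv_fderiv_apply_im_eq_zero hϖ him Complex.I Complex.I))
  rw [dz_dzbar hϖ, ← ha, ← hb] at hH
  rw [dz_dzbar hϖ, dz_dz_add_dzbar_dzbar hϖ, ← ha, ← hb]
  have hq : IsQuantization M (fun z => (qOf z ^ 2 : ℝ))
      (opQ ^ 2 + (-((a + b) / 4) + 1 / 2 * ((a - b) / 2)) • 1) := by
    -- The factor 2 comes from `q² = 2 (Re z)²`.
    have h := (isQuantization_re_sq hM hϖ).smul 2
    rw [hr.map_zero, hd0, ← hb] at h
    convert h using 1
    · ext z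
      rw [qOf, mul_pow, Real.sq_sqrt (by norm_num)]
      push_cast
      ring
    · simp only [zero_apply]
      module
  have hp : IsQuantization M (fun z => (pOf z ^ 2 : ℝ))
      (opP ^ 2 + (-((a + b) / 4) - 1 / 2 * ((a - b) / 2)) • 1) := by
    have h := (isQuantization_im_sq hM hϖ).smul 2
    rw [hr.map_zero, hd0, ← ha] at h
    convert h using 1
    · ext z
      rw [pOf, mul_pow, Real.sq_sqrt (by norm_num)]
      push_cast
      ring
    · simp only [zero_apply]
      module
  -- With `a`, `b` the second derivatives along `1` and `i`, the constants added to `Q²` and `P²`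
  -- collapse to `-b/2` and `-a/2`. Their mean is `-(a + b)/4`, which is the constant in `H` without
  -- the zero-point `1/2`.
  refine ⟨hH, hq, hp, fun H Aq Ap h1 h2 h3 => ⟨1 / 2 - (a.re + b.re) / 4, -b.re / 2, -a.re / 2,
    -(a.re + b.re) / 4, ?_, ?_, ?_, by ring, ?_, ?_, by ring⟩⟩
  · rw [h1.unique hH]
    convert isGroundStateEnergy_oscillator (1 / 2 - (a.re + b.re) / 4) using 3
    push_cast
    rw [hare, hbre]
  · rw [h2.unique hq]
    convert isMinOf_opQ_sq (-b.re / 2) using 3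
    push_cast
    rw [hbre]
    ring
  · rw [h3.unique hp]
    convert isMinOf_opP_sq (-a.re / 2) using 3
    push_cast
    rw [hare]
    ring
  · push_cast
    rw [hare, hbre]
  · push_cast
    rw [hare, hbre]
    ring
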